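/- Let $X$ be a separable complete metric space with metric $\rho$ and let $T\colon X\to X$ be continuous. **Strong approximate product structure (SAPS).** A specification is a finite sequence $\xi=(\langle x_j,n_j\rangle)_{j=1}^k$, $k\ge 1$, with $x_j\in X$ and integers $n_j\ge 1$. A point $y\in X$ $(\varepsilon,\delta_1,\delta_2)$-approximately traces $\xi$ if $\rho(T^t(x_1),T^t(y))<\varepsilon$ for $0\le t<n_1$, and there are integers $s_1,\dots,s_{k-1}\ge 0$ such that for each $2\le j\le k$ one has $s_{j-1}\le\delta_2 n_j$ and there is a set $\Lambda_j\subseteq\{0,\dots,n_j-1\}$ with $|\Lambda_j|\ge(1-\delta_1)n_j$ and $$\rho\bigl(T^t(x_j),\,T^{t+\sum_{i=1}^{j-1}(n_i+s_i)}(y)\bigr)<\varepsilon\quad\text{for all }t\in\Lambda_j .$$ $(X,T)$ has SAPS if for all $\varepsilon,\delta_1,\delta_2>0$ there is an integer $N\ge 0$ such that every specification with $n_j\ge N$ for all $j$ is $(\varepsilon,\delta_1,\delta_2)$-approximately traced by some point of $X$. **Generic points.** Let $\mathcal M(X)$ be the space of Borel probability measures on $X$ with the topology of weak convergence, and $\mathcal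 M_T(X)$ the set of $T$-invariant ones. For $x\in X$ and $n\ge1$ let $\mathcal E(x,n)=\frac1n\sum_{i=0}^{n-1}\delta_{T^i(x)}$, and let $V(x)\subseteq\mathcal M(X)$ be the set of limit points of the sequence $(\mathcal E(x,n))_{n\ge1}$ (the limits of its convergent subsequences). For $\mu\in\mathcal M_T(X)$ put $G_\mu=\{x:\mathcal E(x,n)\to\mu\}$, and for $V,U\subseteq\mathcal M(X)$ put $G^V=\{x: V\subseteq V(x)\}$, $G_V=\{x: V(x)\subseteq V\}$, $G(V)=G^V\cap G_V$, and ${}^{U}G=\{x:V(x)\cap U\ne\emptyset\}$. **Complexity.** $\boldsymbol\Sigma^0_1$ is the class of open sets, $\boldsymbol\Pi^0_n$ consists of the complements of $\boldsymbol\Sigma^0_n$ sets, and $\boldsymbol\Sigma^0_n$ for $n\ge2$ consists of the countable unions $\bigcup_i A_i$ with each $A_i\in\boldsymbol\Pi^0_{m_i}$ for some $1\le m_i<n$. A set $A\subseteq X$ is $\boldsymbol\Sigma^0_n$-hard if $A\notin\boldsymbol\Pi^0_n$, is $\boldsymbol\Pi^0_n$-hard if $A\notin\boldsymbol\Sigma^0_n$,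 and is $\boldsymbol\Pi^0_n$-complete if $A\in\boldsymbol\Pi^0_n\setminus\boldsymbol\Sigma^0_n$. **Theorem.** Suppose that $(X,T)$ has the strong approximate product structure. (i) If $|\mathcal M_T(X)|\ge 2$, then for every $\mu\in\mathcal M_T(X)$ the set $G_\mu$ is $\boldsymbol\Pi^0_3$-complete. (ii) For every nonempty closed connected set $V\subseteq\mathcal M_T(X)$ with nonempty complement $U=\mathcal M_T(X)\setminus V$, the sets $G_V$ and $G(V)$ are $\boldsymbol\Pi^0_3$-hard, the set ${}^{U}G$ is $\boldsymbol\Sigma^0_3$-hard, and the set $G^V$ is $\boldsymbol\Pi^0_2$-complete. Moreover, the sets $G_V$, $G^V$, $G(V)$ and ${}^{U}G$ are all dense in $X$. -/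

import Mathlib

open Set Filter Topology MeasureTheory

noncomputable section

namespace PolishDyn

/-! ### The finite levels of the Borel hierarchy -/

/-- `IsSigma0 n A`: the set `A` belongs to the (boldface) class `Σ⁰ₙ`, for `n ≥ 1`. The class
`Σ⁰₁` consists of the open sets, and `Σ⁰ₙ` of the countable unions `⋃ i, A i` in which each
`A i` is in `Π⁰` of some level `m i < n`, i.e. has its complement in `Σ⁰` of that level. -/
inductive IsSigma0 {X : Type*} [TopologicalSpace X] : ℕ → Set X → Prop
  | isOpen (A : Set X) (hA : IsOpen A) : IsSigma0 1 A
  | iUnion (n : ℕ) (m : ℕ → ℕ) (A : ℕ → Set X) (hm : ∀ i, 1 ≤ m i ∧ m i < n)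
      (hA : ∀ i, IsSigma0 (m i) (A i)ᶜ) : IsSigma0 n (⋃ i, A i)

/-- The class `Π⁰ₙ`: complements of `Σ⁰ₙ` sets. -/
def IsPi0 {X : Type*} [TopologicalSpace X] (n : ℕ) (A : Set X) : Prop :=
  IsSigma0 n Aᶜ

/-- `A` is `Σ⁰ₙ`-hard: it is not a `Π⁰ₙ` set. -/
def IsSigma0Hard {X : Type*} [TopologicalSpace X] (n : ℕ) (A : Set X) : Prop :=
  ¬ IsPi0 n A

/-- `A` is `Π⁰ₙ`-hard: it is not a `Σ⁰ₙ` set. -/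
def IsPi0Hard {X : Type*} [TopologicalSpace X] (n : ℕ) (A : Set X) : Prop :=
  ¬ IsSigma0 n A

/-- `A` is `Π⁰ₙ`-complete: it is a `Π⁰ₙ` set and it is `Π⁰ₙ`-hard. -/
def IsPi0Complete {X : Type*} [TopologicalSpace X] (n : ℕ) (A : Set X) : Prop :=
  IsPi0 n A ∧ IsPi0Hard n A

/-! ### The strong approximate product structure -/

/-- The Bowen ball of radius `ε` around `x` along the finite set `Λ` of times. -/
def bowenBall {X : Type*} [MetricSpace X] (T : X → X) (Λ : Finset ℕ) (x : X) (ε : ℝ) : Set X :=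
  {y | ∀ t ∈ Λ, dist (T^[t] x) (T^[t] y) < ε}

/-- The point `y` `(ε, δ₁, δ₂)`-approximately-traces the specification `ξ`, a sequence of
`k + 1` orbit segments `ξ j = (x_j, n_j)`, `0 ≤ j ≤ k`. The gap between the segments `j` and
`j + 1` is `s j`, so that the tracing of the segment `j + 1` starts at the time
`∑ i ≤ j, (n_i + s_i)`. -/
def ApproxTraces {X : Type*} [MetricSpace X] (T : X → X) (ε δ₁ δ₂ : ℝ) {k : ℕ}
    (ξ : Fin (k + 1) → X × ℕ+) (y : X) : Prop :=
  y ∈ bowenBall T (Finset.range (ξ 0).2) (ξ 0).1 ε ∧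
  ∃ s : Fin k → ℕ, ∀ j : Fin k,
    (s j : ℝ) ≤ δ₂ * ((ξ j.succ).2 : ℕ) ∧
    ∃ Λ : Finset ℕ, Λ ⊆ Finset.range (ξ j.succ).2 ∧
      (1 - δ₁) * ((ξ j.succ).2 : ℕ) ≤ (Λ.card : ℝ) ∧
      T^[∑ i ∈ Finset.Iic j, (((ξ i.castSucc).2 : ℕ) + s i)] y ∈
        bowenBall T Λ (ξ j.succ).1 ε

/-- The strong approximate product structure of `(X, T)` (for the given metric of `X`). -/
def HasSAPS {X : Type*} [MetricSpace X] (T : X → X) : Prop :=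
  ∀ ε δ₁ δ₂ : ℝ, 0 < ε → 0 < δ₁ → 0 < δ₂ →
    ∃ N : ℕ, ∀ (k : ℕ) (ξ : Fin (k + 1) → X × ℕ+), (∀ j, N ≤ ((ξ j).2 : ℕ)) →
      ∃ y : X, ApproxTraces T ε δ₁ δ₂ ξ y

/-! ### Invariant measures and statistical behaviour of orbits

`ProbabilityMeasure X` carries the topology of weak convergence. -/

/-- The set of `T`-invariant Borel probability measures. -/
def invMeasures {X : Type*} [MeasurableSpace X] (T : X → X) : Set (ProbabilityMeasure X) :=
  {μ | MeasurePreserving T (μ : Measure X) (μ : Measure X)}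

/-- The empirical measure `(1/n) (δ_x + δ_{T x} + ⋯ + δ_{T^{n-1} x})`. -/
def emp {X : Type*} [MeasurableSpace X] (T : X → X) (x : X) (n : ℕ+) : ProbabilityMeasure X :=
  ⟨((n : ℕ) : ENNReal)⁻¹ • ∑ i ∈ Finset.range n, Measure.dirac (T^[i] x), ⟨by
    simp only [Measure.smul_apply, Measure.finsetSum_apply, measure_univ, Finset.sum_const,
      Finset.card_range, nsmul_eq_mul, mul_one, smul_eq_mul]
    exact ENNReal.inv_mul_cancel (by simp) (by simp)⟩⟩

/-- The set `G_μ` of `μ`-generic points. -/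
def genericPts {X : Type*} [MetricSpace X] [MeasurableSpace X] [BorelSpace X] (T : X → X)
    (μ : ProbabilityMeasure X) : Set X :=
  {x | Tendsto (fun n : ℕ => emp T x n.succPNat) atTop (𝓝 μ)}

/-- The set `V(x)` of limit points of the sequence of empirical measures of `x`. -/
def limitMeasures {X : Type*} [MetricSpace X] [MeasurableSpace X] [BorelSpace X] (T : X → X)
    (x : X) : Set (ProbabilityMeasure X) :=
  {μ | MapClusterPt μ atTop (fun n : ℕ => emp T x n.succPNat)}

/-- `G^V`, the set of points `x` with `V ⊆ V(x)`. -/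
def upperG {X : Type*} [MetricSpace X] [MeasurableSpace X] [BorelSpace X] (T : X → X)
    (V : Set (ProbabilityMeasure X)) : Set X :=
  {x | V ⊆ limitMeasures T x}

/-- `G_V`, the set of points `x` with `V(x) ⊆ V`. -/
def lowerG {X : Type*} [MetricSpace X] [MeasurableSpace X] [BorelSpace X] (T : X → X)
    (V : Set (ProbabilityMeasure X)) : Set X :=
  {x | limitMeasures T x ⊆ V}

/-- `G(V) = G^V ∩ G_V`, the set of generic points for `V`. -/
def genericG {X : Type*} [MetricSpace X] [MeasurableSpace X] [BorelSpace X] (T : X → X)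
    (V : Set (ProbabilityMeasure X)) : Set X :=
  upperG T V ∩ lowerG T V

/-- `^U G`, the set of points `x` for which `V(x)` meets `U`. -/
def meetG {X : Type*} [MetricSpace X] [MeasurableSpace X] [BorelSpace X] (T : X → X)
    (U : Set (ProbabilityMeasure X)) : Set X :=
  {x | (limitMeasures T x ∩ U).Nonempty}

end PolishDyn

end

/-! SAPS allows an orbit to be built in stages: keep a long initial segment up to a small error,
then append many blocks of one fixed length whose averages have a given invariant measure as their
mean. The empirical measures then move almost along a straight line to that measure
(`HasSAPS.exists_extension`). Infinitely many stages with summable errors give, near any point, an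
orbit whose empirical measures follow any prescribed sequence of invariant measures
(`HasSAPS.exists_follow`). Weak convergence becomes norm convergence under an embedding in a Banach
space (`isInducing_embed`), where the strong law of large numbers makes every invariant measure,
ergodic or not, a possible target (`exists_tendsto_avg`).

Density: as V is connected, some sequence in V has vanishing steps and accumulates at all of V
(`exists_slow_dense_sequence`). Following it leads to `strongG`, which lies in G_V, G^V and G(V).

Level three: some v in V is a limit of measures e k in U (`exists_tendsto_embed_of_notMem`). Choose
the slow sequence to return to v infinitely often, and at each such index j aim at e (α j) instead,
for α in ℕ^ℕ. The point obtained depends continuously on α. It lies in `strongG` if α tends to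
infinity, and in ᵁG if α repeats one value infinitely often along those indices. By Baire category
no Σ⁰₃ set separates these two kinds of α (`exists_mem_iUnion_isGδ`), so no Σ⁰₃ set contains
`strongG` and misses ᵁG.

Level two: G^V is a dense Gδ set, and for w in U the dense set `strongG T {w}` misses it, so by
Baire G^V is not Fσ. -/

noncomputable section

namespace PolishDyn

open BoundedContinuousFunction

/-! ### The bounded Lipschitz embedding of the space of probability measures -/

section Embedding

variable {X : Type*} [MetricSpace X]

/-- The `1`-Lipschitz functions bounded by `1` in absolute value. -/
abbrev BLip (X : Type*) [MetricSpace X] : Type _ :=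
  {f : X →ᵇ ℝ // LipschitzWith 1 f ∧ ‖f‖ ≤ 1}

/-- The point `x` seen as the evaluation functional on `BLip X`. -/
def evalPt (x : X) : BLip X →ᵇ ℝ :=
  BoundedContinuousFunction.ofNormedAddCommGroup (fun f => f.1 x)
    ((BoundedContinuousFunction.evalCLM ℝ x).continuous.comp continuous_subtype_val) 1
    (fun f => (f.1.norm_coe_le_norm x).trans f.2.2)

@[simp] lemma evalPt_apply (x : X) (f : BLip X) : evalPt x f = f.1 x := rfl

lemma norm_evalPt_le (x : X) : ‖evalPt x‖ ≤ 1 :=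
  BoundedContinuousFunction.norm_ofNormedAddCommGroup_le _ zero_le_one _

lemma dist_evalPt_le (x y : X) : dist (evalPt x) (evalPt y) ≤ dist x y := by
  rw [BoundedContinuousFunction.dist_le dist_nonneg]
  intro f
  simpa using f.2.1.dist_le_mul x y

lemma continuous_evalPt : Continuous (evalPt : X → (BLip X →ᵇ ℝ)) :=
  (LipschitzWith.of_dist_le_mul (K := 1) fun x y => by simpa using dist_evalPt_le x y).continuous

lemma norm_smul_sum_le {F : Type*} [SeminormedAddCommGroup F] [NormedSpace ℝ F] {g : ℕ → F}
    {C : ℝ} {n : ℕ} (hC : 0 ≤ C) (h : ∀ t < n, ‖g t‖ ≤ C) :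
    ‖(n : ℝ)⁻¹ • ∑ t ∈ Finset.range n, g t‖ ≤ C := by
  rcases Nat.eq_zero_or_pos n with rfl | hn
  · simpa using hC
  have hn' : (0 : ℝ) < n := by exact_mod_cast hn
  rw [norm_smul, norm_inv, Real.norm_natCast, inv_mul_le_iff₀ hn']
  exact (norm_sum_le_of_le _ fun t ht => h t (Finset.mem_range.1 ht)).trans (by simp)

/-- The average of `evalPt` along the orbit segment of length `n` of `x`. -/
def avg (T : X → X) (n : ℕ) (x : X) : BLip X →ᵇ ℝ :=
  (n : ℝ)⁻¹ • ∑ t ∈ Finset.range n, evalPt (T^[t] x)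

lemma norm_avg_le (T : X → X) (n : ℕ) (x : X) : ‖avg T n x‖ ≤ 1 :=
  norm_smul_sum_le zero_le_one fun _ _ => norm_evalPt_le _

lemma continuous_avg {T : X → X} (hT : Continuous T) (n : ℕ) : Continuous (avg T n) :=
  Continuous.const_smul (continuous_finsetSum _ fun t _ =>
    (continuous_evalPt.comp (hT.iterate t) : Continuous fun x => evalPt (T^[t] x))) (n : ℝ)⁻¹

variable [MeasurableSpace X] [BorelSpace X]

/-- Integrals of nonnegative `1`-Lipschitz functions are controlled by the Lévy–Prokhorov
distance. -/
lemma integral_le_of_levyProkhorovEDist_lt_of_lipschitz {μ ν : Measure X} [IsProbabilityMeasure μ]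
    [IsProbabilityMeasure ν] {ε : ℝ} (hε : 0 < ε)
    (h : levyProkhorovEDist μ ν < ENNReal.ofReal ε) (f : X →ᵇ ℝ) (hf : LipschitzWith 1 f)
    (hf0 : ∀ x, 0 ≤ f x) (hf2 : ‖f‖ ≤ 2) :
    ∫ x, f x ∂μ ≤ ∫ x, f x ∂ν + 3 * ε := by
  have h1 := BoundedContinuousFunction.integral_le_of_levyProkhorovEDist_lt μ ν hε h f
    (Eventually.of_forall hf0)
  -- Since `f` is `1`-Lipschitz, the `ε`-thickening of a superlevel set of `f` lies in the same
  -- superlevel set of `f + ε`. The shift costs `ε`, and the term `ε * ‖f‖` at most `2 * ε`.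
  let g : X →ᵇ ℝ := f + BoundedContinuousFunction.const X ε
  have hg (x) : g x = f x + ε := rfl
  have hg0 : ∀ x, 0 ≤ g x := fun x => by rw [hg]; have := hf0 x; linarith
  have h2 := BoundedContinuousFunction.integral_eq_integral_meas_le g ν (Eventually.of_forall hg0)
  have h3 : ∫ x, g x ∂ν = ∫ x, f x ∂ν + ε := by
    simp only [hg]
    rw [integral_add (f.integrable ν) (integrable_const _)]; simp
  have hfg : ‖f‖ ≤ ‖g‖ := by
    refine (BoundedContinuousFunction.norm_le (norm_nonneg _)).2 fun x => ?_
    refine le_trans ?_ (g.norm_coe_le_norm x)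
    rw [Real.norm_of_nonneg (hf0 x), Real.norm_of_nonneg (hg0 x), hg]; linarith
  have anti : Antitone fun t : ℝ => ν.real {a | t ≤ g a} := fun s t hst =>
    measureReal_mono (fun a ha => le_trans hst ha)
  have antif : Antitone fun t : ℝ => ν.real (Metric.thickening ε {a | t ≤ f a}) := fun s t hst =>
    measureReal_mono (Metric.thickening_subset_of_subset ε fun a ha => le_trans hst ha)
  have int_of {u : ℝ → ℝ} (hu : Antitone u) (c : ℝ) : IntegrableOn u (Ioc 0 c) :=
    (AntitoneOn.integrableOn_isCompact (isCompact_Icc (a := 0) (b := c))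
      (hu.antitoneOn _)).mono_set Ioc_subset_Icc_self
  have h4 : ∫ t in Ioc 0 ‖f‖, ν.real (Metric.thickening ε {a | t ≤ f a}) ≤
      ∫ t in Ioc 0 ‖g‖, ν.real {a | t ≤ g a} := by
    refine (setIntegral_mono (int_of antif _) (int_of anti _) fun t => ?_).trans
      (setIntegral_mono_set (int_of anti _) (Eventually.of_forall fun _ => measureReal_nonneg)
        (Ioc_subset_Ioc_right hfg).eventuallyLE)
    refine measureReal_mono fun a ha => ?_
    obtain ⟨b, hb, hab⟩ := Metric.mem_thickening_iff.1 ha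
    have := hf.dist_le_mul a b
    rw [Real.dist_eq] at this
    have := neg_abs_le (f a - f b)
    simp only [mem_ofPred_eq, hg] at hb ⊢
    simp at *
    linarith
  have : ε * ‖f‖ ≤ ε * 2 := by gcongr
  linarith

variable [TopologicalSpace.SeparableSpace X]

lemma Continuous.integrable_of_norm_le {F : Type*} [NormedAddCommGroup F]
    (μ : Measure X) [IsFiniteMeasure μ] {g : X → F} (hg : Continuous g) {C : ℝ}
    (hC : ∀ x, ‖g x‖ ≤ C) : Integrable g μ := by
  borelize F
  have : SecondCountableTopology X := UniformSpace.secondCountable_of_separable X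
  exact Integrable.of_bound hg.stronglyMeasurable.aestronglyMeasurable C (Eventually.of_forall hC)

/-- The barycentre of `evalPt`, which embeds the probability measures into a Banach space. -/
def embed (μ : ProbabilityMeasure X) : BLip X →ᵇ ℝ := ∫ x, evalPt x ∂(μ : Measure X)

lemma integrable_evalPt (μ : Measure X) [IsFiniteMeasure μ] : Integrable (evalPt (X := X)) μ :=
  Continuous.integrable_of_norm_le μ continuous_evalPt norm_evalPt_le

lemma embed_apply (μ : ProbabilityMeasure X) (f : BLip X) :
    embed μ f = ∫ x, f.1 x ∂(μ : Measure X) := by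
  have := (BoundedContinuousFunction.evalCLM ℝ f : (BLip X →ᵇ ℝ) →L[ℝ] ℝ).integral_comp_comm
    (integrable_evalPt (μ : Measure X))
  simpa [embed] using this.symm

lemma dist_embed_le_of_levyProkhorovEDist_lt {μ ν : ProbabilityMeasure X} {ε : ℝ} (hε : 0 < ε)
    (h : levyProkhorovEDist (μ : Measure X) ν < ENNReal.ofReal ε) :
    dist (embed μ) (embed ν) ≤ 3 * ε := by
  rw [BoundedContinuousFunction.dist_le (by positivity)]
  intro f
  rw [embed_apply, embed_apply, Real.dist_eq, abs_sub_le_iff]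
  -- Adding `1` makes the function nonnegative; for probability measures the constant cancels in the
  -- difference.
  let g : X →ᵇ ℝ := f.1 + BoundedContinuousFunction.const X 1
  have hg (x) : g x = f.1 x + 1 := rfl
  have hgl : LipschitzWith 1 g := LipschitzWith.of_dist_le_mul fun x y => by
    simpa [hg] using f.2.1.dist_le_mul x y
  have hg0 (x) : 0 ≤ g x := by
    have := (f.1.norm_coe_le_norm x).trans f.2.2
    rw [Real.norm_eq_abs, abs_le] at this
    rw [hg]; linarith
  have hg2 : ‖g‖ ≤ 2 := by
    refine (BoundedContinuousFunction.norm_le (by norm_num)).2 fun x => ?_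
    have := (f.1.norm_coe_le_norm x).trans f.2.2
    rw [Real.norm_eq_abs, abs_le] at this
    rw [Real.norm_of_nonneg (hg0 x), hg]; linarith
  have h3 (ν : ProbabilityMeasure X) :
      ∫ x, g x ∂(ν : Measure X) = ∫ x, f.1 x ∂(ν : Measure X) + 1 := by
    simp only [hg]
    rw [integral_add (f.1.integrable _) (integrable_const _)]; simp
  have h1 := integral_le_of_levyProkhorovEDist_lt_of_lipschitz hε h g hgl hg0 hg2
  rw [levyProkhorovEDist_comm] at h
  have h2 := integral_le_of_levyProkhorovEDist_lt_of_lipschitz hε h g hgl hg0 hg2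
  simp only [h3] at h1 h2
  constructor <;> linarith

lemma continuous_embed : Continuous (embed (X := X)) := by
  rw [continuous_iff_continuousAt]
  intro μ
  rw [ContinuousAt, Metric.tendsto_nhds]
  intro ε hε
  have hc := (LevyProkhorov.continuous_ofMeasure_probabilityMeasure (Ω := X)).tendsto μ
  have hc' := (EMetric.tendsto_nhds.1 hc) (ENNReal.ofReal (ε / 4)) (by simpa using hε)
  filter_upwards [hc'] with ν hν
  rw [LevyProkhorov.edist_probabilityMeasure_def] at hν
  have := dist_embed_le_of_levyProkhorovEDist_lt (μ := ν) (ν := μ) (by positivity) hν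
  linarith

lemma tendsto_integral_of_tendsto_embed {γ : Type*} {F : Filter γ}
    {μs : γ → ProbabilityMeasure X} {μ : ProbabilityMeasure X}
    (h : Tendsto (fun i => embed (μs i)) F (𝓝 (embed μ))) {f : X → ℝ} {C : ℝ} {L : NNReal}
    (hb : ∀ x, ‖f x‖ ≤ C) (hL : LipschitzWith L f) :
    Tendsto (fun i => ∫ x, f x ∂(μs i : Measure X)) F (𝓝 (∫ x, f x ∂(μ : Measure X))) := by
  let c : ℝ := max (max C L) 1
  have hc : 0 < c := lt_of_lt_of_le one_pos (le_max_right _ _)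
  have hfd (x y : X) : |f x - f y| ≤ c * dist x y := by
    have := hL.dist_le_mul x y
    rw [Real.dist_eq] at this
    refine this.trans ?_
    gcongr
    exact (le_max_right _ _).trans (le_max_left _ _)
  have hfb (x : X) : |c⁻¹ * f x| ≤ 1 := by
    rw [abs_mul, abs_of_pos (inv_pos.2 hc), inv_mul_le_iff₀ hc, mul_one]
    exact (hb x).trans ((le_max_left _ _).trans (le_max_left _ _))
  have hgl : LipschitzWith 1 (fun x => c⁻¹ * f x) := LipschitzWith.of_dist_le_mul fun x y => by
    rw [Real.dist_eq, ← mul_sub, abs_mul, abs_of_pos (inv_pos.2 hc), inv_mul_le_iff₀ hc]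
    simpa using hfd x y
  let g : BLip X := ⟨BoundedContinuousFunction.ofNormedAddCommGroup (fun x => c⁻¹ * f x)
    hgl.continuous 1 hfb, hgl, BoundedContinuousFunction.norm_ofNormedAddCommGroup_le _ zero_le_one _⟩
  have hg := ((BoundedContinuousFunction.evalCLM ℝ g).continuous.tendsto (embed μ)).comp h
  have hg' := hg.const_mul c
  have key (ν : ProbabilityMeasure X) : c * embed ν g = ∫ x, f x ∂(ν : Measure X) := by
    rw [embed_apply, ← integral_const_mul]
    refine integral_congr_ae (Eventually.of_forall fun x => ?_)
    change c * (c⁻¹ * f x) = f x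
    field_simp
  simpa only [Function.comp_def, BoundedContinuousFunction.evalCLM_apply, key] using hg'

/-- Continuity needs uniformity over `BLip X`, which the Lévy–Prokhorov distance supplies.
Conversely, every bounded Lipschitz function is a multiple of an element of `BLip X`, and such
functions determine weak convergence. -/
theorem isInducing_embed : IsInducing (embed (X := X)) := by
  rw [isInducing_iff_nhds]
  intro μ
  refine le_antisymm (continuous_embed.tendsto μ).le_comap ?_
  have : Tendsto id (comap embed (𝓝 (embed μ))) (𝓝 μ) := by
    rw [tendsto_iff_forall_lipschitz_integral_tendsto]
    rintro f ⟨C, hC⟩ ⟨L, hL⟩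
    rcases isEmpty_or_nonempty X with hX | ⟨⟨x₀⟩⟩
    · exact hX.elim μ.nonempty.some
    · refine tendsto_integral_of_tendsto_embed (C := ‖f x₀‖ + C) tendsto_comap (fun x => ?_) hL
      have := hC x x₀
      rw [dist_eq_norm] at this
      have := norm_le_norm_add_norm_sub' (f x) (f x₀)
      linarith
  exact tendsto_id'.1 this

/-- A barycentre lies in the closed linear span of the image of `X`, which is separable even if the
ambient space is not. -/
lemma isSeparable_range_embed : TopologicalSpace.IsSeparable (range (embed (X := X))) := by
  have h := ((TopologicalSpace.isSeparable_range (continuous_evalPt (X := X))).span (R := ℝ)).closure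
  refine h.mono ?_
  rintro _ ⟨μ, rfl⟩
  refine Convex.integral_mem (Submodule.convex _).closure isClosed_closure
    (Eventually.of_forall fun x => subset_closure (Submodule.subset_span ⟨x, rfl⟩))
    (integrable_evalPt _)

lemma embed_emp (T : X → X) (x : X) (n : ℕ+) : embed (emp T x n) = avg T n x := by
  have : ((emp T x n : ProbabilityMeasure X) : Measure X) =
    ((n : ℕ) : ENNReal)⁻¹ • ∑ i ∈ Finset.range n, Measure.dirac (T^[i] x) := rfl
  rw [embed, this, integral_smul_measure, integral_finsetSum_measure fun i _ => integrable_evalPt _]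
  simp [avg, integral_dirac]

/-- By the strong law of large numbers, an invariant measure is a limit of averages of orbit
segments of any prescribed length. -/
lemma exists_tendsto_avg {T : X → X} (hT : Continuous T) {μ : ProbabilityMeasure X}
    (hμ : μ ∈ invMeasures T) {n : ℕ} (hn : 0 < n) :
    ∃ x : ℕ → X, Tendsto (fun J : ℕ => (J : ℝ)⁻¹ • ∑ i ∈ Finset.range J, avg T n (x i)) atTop
      (𝓝 (embed μ)) := by
  borelize (BLip X →ᵇ ℝ)
  have : SecondCountableTopology X := UniformSpace.secondCountable_of_separable X
  -- Independent samples of `μ`: the averages of their orbit segments are i.i.d. and bounded, and by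
  -- invariance of `μ` their mean is `embed μ`.
  let P : Measure (ℕ → X) := Measure.infinitePi fun _ => (μ : Measure X)
  have hev (i : ℕ) : MeasurePreserving (fun ω : ℕ → X => ω i) P μ :=
    measurePreserving_eval_infinitePi _ i
  have hc := continuous_avg hT n
  have hi : Integrable (avg T n) (μ : Measure X) :=
    Continuous.integrable_of_norm_le _ hc (norm_avg_le T n)
  have hslln := ProbabilityTheory.strong_law_ae (μ := P) (fun i ω => avg T n (ω i))
    ((hev 0).integrable_comp_of_integrable hi)
    (fun i j hij => (ProbabilityTheory.iIndepFun_infinitePi (P := fun _ : ℕ => (μ : Measure X))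
      (X := fun _ => avg T n) (fun _ => hc.measurable)).indepFun hij)
    (fun i => by
      have (k : ℕ) : Measure.map (fun ω : ℕ → X => avg T n (ω k)) P = Measure.map (avg T n) μ := by
        rw [← (hev k).map_eq, Measure.map_map hc.measurable (hev k).measurable]; rfl
      exact ⟨(hc.measurable.comp (hev i).measurable).aemeasurable,
        (hc.measurable.comp (hev 0).measurable).aemeasurable, by rw [this, this]⟩)
  obtain ⟨ω, hω⟩ := hslln.exists
  refine ⟨ω, ?_⟩
  have h1 : ∫ ω, avg T n (ω 0) ∂P = ∫ x, avg T n x ∂(μ : Measure X) := by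
    rw [← (hev 0).map_eq, integral_map (hev 0).measurable.aemeasurable
      hc.stronglyMeasurable.aestronglyMeasurable]
  have h2 : ∫ x, avg T n x ∂(μ : Measure X) = embed μ := by
    have hit (t : ℕ) : MeasurePreserving T^[t] (μ : Measure X) μ :=
      MeasurePreserving.iterate hμ t
    have hii (t : ℕ) : ∫ x, evalPt (T^[t] x) ∂(μ : Measure X) = embed μ := by
      rw [embed]
      conv_rhs => rw [← (hit t).map_eq]
      rw [integral_map (hit t).measurable.aemeasurable
        continuous_evalPt.stronglyMeasurable.aestronglyMeasurable]
    simp only [avg]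
    rw [integral_smul, integral_finsetSum _ fun t _ => show Integrable (fun x => evalPt (T^[t] x)) _ from
      (hit t).integrable_comp_of_integrable (integrable_evalPt _)]
    simp only [hii, Finset.sum_const, Finset.card_range, ← Nat.cast_smul_eq_nsmul ℝ]
    rw [smul_smul, inv_mul_cancel₀ (by exact_mod_cast hn.ne'), one_smul]
  rw [← h2, ← h1]
  exact hω

end Embedding

/-! ### Tracing sequences of orbit segments -/

section Tracing

variable {X : Type*} [MetricSpace X] {T : X → X}

/-- The tracing property for an orbit segment followed by segments of equal length. -/
lemma HasSAPS.exists_trace (h : HasSAPS T) {ε : ℝ} (hε : 0 < ε) :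
    ∃ N₀ : ℕ, ∀ (y : X) (x : ℕ → X) (N n k : ℕ), 0 < N → 0 < n → N₀ ≤ N → N₀ ≤ n →
      ∃ (z : X) (s : ℕ → ℕ), (∀ t < N, dist (T^[t] y) (T^[t] z) < ε) ∧
        ∀ j < k, (s j : ℝ) ≤ ε * n ∧ ∃ Λ ⊆ Finset.range n, (1 - ε) * n ≤ (Λ.card : ℝ) ∧
          ∀ t ∈ Λ, dist (T^[t] (x j))
            (T^[t] (T^[N + ∑ i ∈ Finset.range j, (n + s i) + s j] z)) < ε := by
  obtain ⟨N₀, hN₀⟩ := h ε ε ε hε hε hε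
  refine ⟨N₀, fun y x N n k hN hn hNN hNn => ?_⟩
  let ξ : Fin (k + 1) → X × ℕ+ := Fin.cons (y, ⟨N, hN⟩) fun j => (x j, ⟨n, hn⟩)
  obtain ⟨z, hz, s, hs⟩ := hN₀ k ξ (fun j => by
    induction j using Fin.cases with
    | zero => simpa [ξ] using hNN
    | succ j => simpa [ξ] using hNn)
  let s' : ℕ → ℕ := fun j => if hj : j < k then s ⟨j, hj⟩ else 0
  have hs' (j : Fin k) : s' j = s j := by simp [s']
  -- Regrouping: each gap is now counted with the segment after it instead of the one before it.
  have start (j : Fin k) : ∑ i ∈ Finset.Iic j, (((ξ i.castSucc).2 : ℕ) + s i) =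
      N + ∑ i ∈ Finset.range j, (n + s' i) + s' j := by
    let g : ℕ → ℕ := fun i => (if i = 0 then N else n) + s' i
    have h1 : ∑ i ∈ Finset.Iic j, (((ξ i.castSucc).2 : ℕ) + s i) = ∑ i ∈ Finset.Iic (j : ℕ), g i := by
      rw [← Fin.map_valEmbedding_Iic, Finset.sum_map]
      refine Finset.sum_congr rfl fun i _ => ?_
      simp only [g, Fin.valEmbedding_apply, hs']
      congr 1
      obtain ⟨i, hi⟩ := i
      cases i with
      | zero => rfl
      | succ i => rfl
    have h2 (j : ℕ) : ∑ i ∈ Finset.range (j + 1), g i =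
        N + ∑ i ∈ Finset.range j, (n + s' i) + s' j := by
      induction j with
      | zero => simp [g]
      | succ j ih => rw [Finset.sum_range_succ, ih, Finset.sum_range_succ]; simp [g]; ring
    rw [h1, ← h2, Nat.range_succ_eq_Iic]
  refine ⟨z, s', fun t ht => hz t (by simpa [ξ] using ht), fun j hj => ?_⟩
  obtain ⟨h1, Λ, hΛ, hc, hb⟩ := hs ⟨j, hj⟩
  rw [start] at hb
  rw [← hs' ⟨j, hj⟩] at h1
  exact ⟨h1, Λ, hΛ, hc, hb⟩

/-- The sum of `evalPt` along the orbit segment of length `n` of `x`. -/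
def orbitSum (T : X → X) (n : ℕ) (x : X) : BLip X →ᵇ ℝ :=
  ∑ t ∈ Finset.range n, evalPt (T^[t] x)

lemma orbitSum_eq_smul_avg (n : ℕ) (x : X) : orbitSum T n x = (n : ℝ) • avg T n x := by
  rcases Nat.eq_zero_or_pos n with rfl | hn
  · simp [orbitSum]
  · rw [avg, smul_smul, mul_inv_cancel₀ (by exact_mod_cast hn.ne'), one_smul, orbitSum]

lemma norm_orbitSum_le (n : ℕ) (x : X) : ‖orbitSum T n x‖ ≤ n :=
  (norm_sum_le_of_le _ fun _ _ => norm_evalPt_le _).trans (by simp)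

lemma orbitSum_add (a b : ℕ) (x : X) :
    orbitSum T (a + b) x = orbitSum T a x + orbitSum T b (T^[a] x) := by
  rw [orbitSum, Finset.sum_range_add]
  congr 1
  refine Finset.sum_congr rfl fun t _ => ?_
  rw [← Function.iterate_add_apply, add_comm]

/-- Times in `Λ` cost `ε` each; the others number at most `ε * n` and cost at most `2` each. -/
lemma norm_orbitSum_sub_le {x y : X} {ε : ℝ} {n : ℕ} {Λ : Finset ℕ} (hΛ : Λ ⊆ Finset.range n)
    (hc : (1 - ε) * n ≤ (Λ.card : ℝ)) (hε : 0 ≤ ε)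
    (h : ∀ t ∈ Λ, dist (T^[t] x) (T^[t] y) < ε) :
    ‖orbitSum T n x - orbitSum T n y‖ ≤ 3 * ε * n := by
  rw [orbitSum, orbitSum, ← Finset.sum_sub_distrib, ← Finset.sum_sdiff hΛ]
  have h1 : ‖∑ t ∈ Λ, (evalPt (T^[t] x) - evalPt (T^[t] y))‖ ≤ ε * Λ.card := by
    refine (norm_sum_le_of_le _ (f := fun t => evalPt (T^[t] x) - evalPt (T^[t] y))
      (n := fun _ => ε) fun t ht => ?_).trans (by simp [mul_comm])
    rw [← dist_eq_norm]
    exact (dist_evalPt_le _ _).trans (h t ht).le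
  have h2 : ‖∑ t ∈ Finset.range n \ Λ, (evalPt (T^[t] x) - evalPt (T^[t] y))‖ ≤
      2 * (n - Λ.card) := by
    refine (norm_sum_le_of_le _ (f := fun t => evalPt (T^[t] x) - evalPt (T^[t] y))
      (n := fun _ => 2) fun t ht => ?_).trans ?_
    · refine (norm_sub_le _ _).trans ?_
      linarith [norm_evalPt_le (T^[t] x), norm_evalPt_le (T^[t] y)]
    · rw [Finset.sum_const, Finset.card_sdiff_of_subset hΛ, Finset.card_range, nsmul_eq_mul,
        Nat.cast_sub (by simpa using Finset.card_le_card hΛ), mul_comm]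
  have h3 : (Λ.card : ℝ) ≤ n := by exact_mod_cast (by simpa using Finset.card_le_card hΛ)
  refine (norm_add_le _ _).trans ?_
  nlinarith

lemma norm_avg_sub_le {x y : X} {ε : ℝ} {n : ℕ} (hε : 0 ≤ ε)
    (h : ∀ t < n, dist (T^[t] x) (T^[t] y) ≤ ε) : ‖avg T n x - avg T n y‖ ≤ ε := by
  have e : avg T n x - avg T n y =
      (n : ℝ)⁻¹ • ∑ t ∈ Finset.range n, (evalPt (T^[t] x) - evalPt (T^[t] y)) := by
    rw [Finset.sum_sub_distrib, avg, avg]; module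
  rw [e]
  refine norm_smul_sum_le hε fun t ht => ?_
  rw [← dist_eq_norm]
  exact (dist_evalPt_le _ _).trans (h t ht)

/-- `m` is, for every `n`, a limit of averages over orbit segments of length `n`. -/
def IsApproximable (T : X → X) (m : BLip X →ᵇ ℝ) : Prop :=
  ∀ n : ℕ, 0 < n → ∃ x : ℕ → X,
    Tendsto (fun J : ℕ => (J : ℝ)⁻¹ • ∑ i ∈ Finset.range J, avg T n (x i)) atTop (𝓝 m)

lemma IsApproximable.norm_le {m : BLip X →ᵇ ℝ} (hm : IsApproximable T m) : ‖m‖ ≤ 1 := by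
  obtain ⟨x, hx⟩ := hm 1 one_pos
  exact le_of_tendsto hx.norm (Eventually.of_forall fun J =>
    norm_smul_sum_le zero_le_one fun _ _ => norm_avg_le _ _ _)

/-- Makes convergence of averages usable for every `J`: the finitely many early `J` are absorbed in
`C`. -/
lemma exists_norm_sum_sub_le {F : Type*} [NormedAddCommGroup F] [NormedSpace ℝ F] {a : ℕ → F}
    {m : F} (ha : ∀ i, ‖a i‖ ≤ 1) (hm : ‖m‖ ≤ 1)
    (h : Tendsto (fun J : ℕ => (J : ℝ)⁻¹ • ∑ i ∈ Finset.range J, a i) atTop (𝓝 m))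
    {ε : ℝ} (hε : 0 < ε) :
    ∃ C : ℝ, 0 ≤ C ∧ ∀ J : ℕ, ‖∑ i ∈ Finset.range J, a i - (J : ℝ) • m‖ ≤ ε * J + C := by
  obtain ⟨J₀, hJ₀⟩ := (Metric.tendsto_atTop.1 h) ε hε
  refine ⟨2 * J₀, by positivity, fun J => ?_⟩
  rcases Nat.eq_zero_or_pos J with rfl | hJpos
  · simp
  have hJ' : (0 : ℝ) < J := by exact_mod_cast hJpos
  rcases le_or_gt J₀ J with hJ | hJ
  · have := (hJ₀ J hJ).le
    rw [dist_eq_norm] at this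
    have e : ∑ i ∈ Finset.range J, a i - (J : ℝ) • m =
        (J : ℝ) • ((J : ℝ)⁻¹ • ∑ i ∈ Finset.range J, a i - m) := by
      rw [smul_sub, smul_smul, mul_inv_cancel₀ hJ'.ne', one_smul]
    rw [e, norm_smul, Real.norm_natCast]
    have : (J : ℝ) * ‖(J : ℝ)⁻¹ • ∑ i ∈ Finset.range J, a i - m‖ ≤ J * ε := by gcongr
    have : (0 : ℝ) ≤ J₀ := by positivity
    linarith
  · have h1 : ‖∑ i ∈ Finset.range J, a i‖ ≤ J :=
      (norm_sum_le_of_le _ fun i _ => ha i).trans (by simp)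
    have h2 : ‖(J : ℝ) • m‖ ≤ J := by
      rw [norm_smul, Real.norm_natCast]; nlinarith
    have h3 : (J : ℝ) ≤ J₀ := by exact_mod_cast hJ.le
    refine (norm_sub_le _ _).trans ?_
    nlinarith

/-- Estimates for a point that traces a segment of length `N` of `y` and then the segments of length
`n` of the points `x j`. -/
lemma norm_orbitSum_trace_le {ε C : ℝ} (hε : 0 < ε) (hε1 : ε ≤ 1) {m : BLip X →ᵇ ℝ}
    (hm1 : ‖m‖ ≤ 1) {x : ℕ → X} {y z : X} {N n k : ℕ} {s : ℕ → ℕ}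
    (hx : ∀ J : ℕ, ‖∑ i ∈ Finset.range J, avg T n (x i) - (J : ℝ) • m‖ ≤ ε * J + C)
    (hz : ∀ t < N, dist (T^[t] y) (T^[t] z) < ε)
    (hs : ∀ j < k, (s j : ℝ) ≤ ε * n ∧ ∃ Λ ⊆ Finset.range n, (1 - ε) * n ≤ (Λ.card : ℝ) ∧
          ∀ t ∈ Λ, dist (T^[t] (x j))
            (T^[t] (T^[N + ∑ i ∈ Finset.range j, (n + s i) + s j] z)) < ε)
    {i : ℕ} (hNi : N ≤ i) (hi : i ≤ N + ∑ i ∈ Finset.range k, (n + s i)) :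
    ‖orbitSum T i z - orbitSum T N y - ((i : ℝ) - N) • m‖ ≤ 6 * ε * i + (C + 4) * n := by
  let b : ℕ → ℕ := fun j => N + ∑ i ∈ Finset.range j, (n + s i)
  have hb0 : b 0 = N := by simp [b]
  have hbs (j : ℕ) : b (j + 1) = b j + s j + n := by
    simp only [b, Finset.sum_range_succ]; ring
  have hn0 : (0 : ℝ) ≤ n := by positivity
  -- the block containing `i`
  have hblock : ∃ j ≤ k, b j ≤ i ∧ (i : ℝ) ≤ b j + 2 * n := by
    have : ∀ l ≤ k, i ≤ b l → ∃ j ≤ l, b j ≤ i ∧ (i : ℝ) ≤ b j + 2 * n := by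
      intro l
      induction l with
      | zero => exact fun _ hl => ⟨0, le_rfl, hb0 ▸ hNi, by
          have : (i : ℝ) ≤ b 0 := by exact_mod_cast hl
          linarith⟩
      | succ l ih =>
        intro hlk hl
        rcases le_or_gt i (b l) with h | h
        · obtain ⟨j, hj, h'⟩ := ih (by omega) h
          exact ⟨j, by omega, h'⟩
        · refine ⟨l, by omega, h.le, ?_⟩
          have h1 := (hs l (by omega)).1
          have h2 : (i : ℝ) ≤ b l + s l + n := by
            rw [hbs] at hl; exact_mod_cast hl
          nlinarith
    exact this k le_rfl hi
  -- sums and lengths up to the start of a block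
  have hsum : ∀ j ≤ k, ‖orbitSum T (b j) z - orbitSum T N z - ∑ i ∈ Finset.range j,
      orbitSum T n (x i)‖ ≤ 4 * ε * n * j := by
    -- Each block costs `3 * ε * n` for the tracing and `ε * n` for the gap.
    intro j
    induction j with
    | zero => simp [hb0]
    | succ j ih =>
      intro hj
      obtain ⟨h1, Λ, hΛ, hc, hd⟩ := hs j (by omega)
      have h2 := norm_orbitSum_sub_le hΛ hc hε.le hd
      have h3 := norm_orbitSum_le (T := T) (s j) (T^[b j] z)
      have h4 : orbitSum T (b (j + 1)) z - orbitSum T N z - ∑ i ∈ Finset.range (j + 1),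
          orbitSum T n (x i) = (orbitSum T (b j) z - orbitSum T N z - ∑ i ∈ Finset.range j,
          orbitSum T n (x i)) + orbitSum T (s j) (T^[b j] z) -
          (orbitSum T n (x j) - orbitSum T n (T^[b j + s j] z)) := by
        rw [hbs, orbitSum_add, orbitSum_add, Finset.sum_range_succ]
        abel
      rw [h4]
      refine (norm_sub_le _ _).trans ((add_le_add_left (norm_add_le _ _) _).trans ?_)
      have := ih (by omega)
      push_cast
      linarith
  have hlen : ∀ j ≤ k, (N : ℝ) + j * n ≤ b j ∧ (b j : ℝ) ≤ N + j * n + ε * n * j := by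
    intro j
    induction j with
    | zero => simp [hb0]
    | succ j ih =>
      intro hj
      obtain ⟨h1, h2⟩ := ih (by omega)
      have h3 := (hs j (by omega)).1
      have h4 : (0 : ℝ) ≤ s j := by positivity
      rw [hbs]
      push_cast
      constructor <;> nlinarith
  obtain ⟨j, hj, hji, hij⟩ := hblock
  obtain ⟨hl1, hl2⟩ := hlen j hj
  have e0 : ‖orbitSum T N z - orbitSum T N y‖ ≤ ε * N := by
    have e : orbitSum T N z - orbitSum T N y = (N : ℝ) • (avg T N z - avg T N y) := by
      rw [orbitSum_eq_smul_avg, orbitSum_eq_smul_avg]; module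
    rw [e, norm_smul, Real.norm_natCast, mul_comm, norm_sub_rev]
    gcongr
    exact norm_avg_sub_le hε.le fun t ht => (hz t ht).le
  have e1 : ‖∑ i ∈ Finset.range j, orbitSum T n (x i) - ((j : ℝ) * n) • m‖ ≤ (ε * j + C) * n := by
    simp only [orbitSum_eq_smul_avg]
    rw [← Finset.smul_sum, mul_comm, ← smul_smul, ← smul_sub, norm_smul, Real.norm_natCast,
      mul_comm]
    gcongr
    exact hx j
  have e2 : ‖((b j : ℝ) - N - j * n) • m‖ ≤ ε * n * j := by
    rw [norm_smul, Real.norm_of_nonneg (by linarith)]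
    nlinarith [norm_nonneg m]
  have e3 : ‖orbitSum T i z - orbitSum T (b j) z‖ ≤ 2 * n := by
    obtain ⟨d, rfl⟩ := Nat.exists_eq_add_of_le hji
    rw [orbitSum_add, add_sub_cancel_left]
    refine (norm_orbitSum_le _ _).trans ?_
    push_cast at hij
    linarith
  have e4 : ‖((i : ℝ) - b j) • m‖ ≤ 2 * n := by
    have : (b j : ℝ) ≤ i := by exact_mod_cast hji
    rw [norm_smul, Real.norm_of_nonneg (by linarith)]
    nlinarith [norm_nonneg m]
  have e5 := hsum j hj
  have e : orbitSum T i z - orbitSum T N y - ((i : ℝ) - N) • m =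
      (orbitSum T i z - orbitSum T (b j) z) + (orbitSum T (b j) z - orbitSum T N z -
        ∑ i ∈ Finset.range j, orbitSum T n (x i)) +
      (∑ i ∈ Finset.range j, orbitSum T n (x i) - ((j : ℝ) * n) • m) +
      (orbitSum T N z - orbitSum T N y) - ((b j : ℝ) - N - j * n) • m - ((i : ℝ) - b j) • m := by
    module
  rw [e]
  have hbi : (b j : ℝ) ≤ i := by exact_mod_cast hji
  have hNn : (0 : ℝ) ≤ N := by positivity
  -- As `N + j * n ≤ b j ≤ i`, all errors proportional to `N` or `j * n` are proportional to `i`;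
  -- the rest is a constant multiple of `n`.
  calc _ ≤ 2 * (n : ℝ) + 4 * ε * n * j + (ε * j + C) * n + ε * N + ε * n * j + 2 * n := by
        refine (norm_sub_le _ _).trans (add_le_add ((norm_sub_le _ _).trans (add_le_add
          ((norm_add_le _ _).trans (add_le_add ((norm_add_le _ _).trans (add_le_add
          ((norm_add_le _ _).trans (add_le_add e3 e5)) e1)) e0)) e2)) e4)
    _ = ε * N + 6 * ε * (j * n) + (C + 4) * n := by ring
    _ ≤ 6 * ε * (N + j * n) + (C + 4) * n := by nlinarith
    _ ≤ _ := by gcongr; linarith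

/-- An orbit segment can be continued by a segment whose averages move towards `m`. -/
lemma HasSAPS.exists_extension (h : HasSAPS T) {m : BLip X →ᵇ ℝ} (hm : IsApproximable T m) {ε : ℝ}
    (hε : 0 < ε) :
    ∃ L : ℕ, ∀ (y : X) (N M : ℕ), L ≤ N → 0 < N → ∃ (z : X) (N' : ℕ), M ≤ N' ∧ N < N' ∧
      (∀ t < N, dist (T^[t] y) (T^[t] z) < ε) ∧ ‖avg T N' z - m‖ ≤ ε ∧
      ∀ i, N ≤ i → i ≤ N' → ‖avg T i z - m‖ ≤ ‖avg T N y - m‖ + ε := by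
  -- `7 * η` covers the tracing error and the absorbed constant, and another `η` the influence of
  -- the initial segment.
  let η : ℝ := min ε 1 / 9
  have hη : 0 < η := by positivity
  have hη1 : η ≤ 1 := by
    have := min_le_right ε 1
    change min ε 1 / 9 ≤ 1; linarith
  have hηε : 9 * η ≤ ε := by
    have := min_le_left ε 1
    change 9 * (min ε 1 / 9) ≤ ε; linarith
  have hm1 := hm.norm_le
  obtain ⟨N₀, hN₀⟩ := h.exists_trace hη
  -- The block length, and with it `C`, is fixed before `N`; so `(C + 4) * n ≤ η * N` for all large
  -- `N`.
  let n := N₀ + 1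
  obtain ⟨x, hx⟩ := hm n (Nat.succ_pos _)
  obtain ⟨C, hC0, hC⟩ := exists_norm_sum_sub_le (fun i => norm_avg_le T n (x i)) hm1 hx hη
  obtain ⟨L, hL⟩ := exists_nat_ge ((C + 4) * n / η)
  refine ⟨max N₀ L, fun y N M hN hNpos => ?_⟩
  have hN' : (0 : ℝ) < N := by exact_mod_cast hNpos
  have hLN : (C + 4) * n ≤ η * N := by
    rw [div_le_iff₀ hη] at hL
    have : (L : ℝ) ≤ N := by exact_mod_cast (le_max_right _ _).trans hN
    nlinarith
  -- So many blocks that the weight of the initial segment in the final average becomes negligible.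
  obtain ⟨k, hk⟩ := exists_nat_ge (2 * N / η + M + 1)
  obtain ⟨z, s, hz, hs⟩ := hN₀ y x N n k hNpos (Nat.succ_pos _) ((le_max_left _ _).trans hN)
    (Nat.le_succ _)
  let N' := N + ∑ i ∈ Finset.range k, (n + s i)
  have hkN' : k + N ≤ N' := by
    have : ∑ i ∈ Finset.range k, 1 ≤ ∑ i ∈ Finset.range k, (n + s i) :=
      Finset.sum_le_sum fun i _ => by simp only [n]; omega
    simp only [Finset.sum_const, Finset.card_range, smul_eq_mul, mul_one] at this
    simp only [N']; omega
  have hkpos : 0 < k := by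
    have h0 : 0 ≤ 2 * N / η := by positivity
    have : (0 : ℝ) < k := by
      have : (0 : ℝ) ≤ M := by positivity
      linarith
    exact_mod_cast this
  have hest : ∀ i : ℕ, N ≤ i → i ≤ N' →
      (i : ℝ) * ‖avg T i z - m‖ ≤ 7 * η * i + N * ‖avg T N y - m‖ := by
    intro i hNi hi
    have h1 := norm_orbitSum_trace_le hη hη1 hm1 hC hz hs hNi hi
    have e : (i : ℝ) • (avg T i z - m) = (orbitSum T i z - orbitSum T N y - ((i : ℝ) - N) • m) +
        (N : ℝ) • (avg T N y - m) := by
      rw [orbitSum_eq_smul_avg, orbitSum_eq_smul_avg]; module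
    have h2 : (i : ℝ) * ‖avg T i z - m‖ = ‖(i : ℝ) • (avg T i z - m)‖ := by
      rw [norm_smul, Real.norm_natCast]
    have h3 : (N : ℝ) ≤ i := by exact_mod_cast hNi
    rw [h2, e]
    refine (norm_add_le _ _).trans ?_
    rw [norm_smul (N : ℝ), Real.norm_natCast]
    nlinarith
  refine ⟨z, N', ?_, by omega, fun t ht => (hz t ht).trans_le (by linarith), ?_, ?_⟩
  · have : (M : ℝ) ≤ k := by
      have : 0 ≤ 2 * N / η := by positivity
      linarith
    have : M ≤ k := by exact_mod_cast this
    omega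
  · have h1 := hest N' (by omega) le_rfl
    have h2 : ‖avg T N y - m‖ ≤ 2 := (norm_sub_le _ _).trans (by linarith [norm_avg_le T N y])
    have h3 : 2 * (N : ℝ) ≤ η * N' := by
      have : 2 * N / η ≤ N' := by
        have : (k : ℝ) + N ≤ N' := by exact_mod_cast hkN'
        have : (0 : ℝ) ≤ M := by positivity
        linarith
      rwa [div_le_iff₀ hη, mul_comm (N' : ℝ)] at this
    have h4 : (0 : ℝ) < N' := by
      have : 0 < N' := by omega
      exact_mod_cast this
    have h5 : (N' : ℝ) * ‖avg T N' z - m‖ ≤ N' * (8 * η) := by nlinarith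
    have := le_of_mul_le_mul_left h5 h4
    linarith
  · intro i hNi hi
    have h1 := hest i hNi hi
    have h3 : (N : ℝ) ≤ i := by exact_mod_cast hNi
    have h4 : (0 : ℝ) < i := by linarith
    have h5 : (i : ℝ) * ‖avg T i z - m‖ ≤ i * (‖avg T N y - m‖ + 7 * η) := by
      nlinarith [norm_nonneg (avg T N y - m)]
    have := le_of_mul_le_mul_left h5 h4
    linarith

end Tracing

/-! ### Points whose averages follow a prescribed sequence of targets -/

section Follow

variable {X : Type*} [MetricSpace X] {T : X → X}

lemma iterate_dist_limit_le (hT : Continuous T) {C : ℝ} {y : ℕ → X} {N : ℕ → ℕ} {x : X}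
    (hN : Monotone N) (hx : Tendsto y atTop (𝓝 x))
    (h : ∀ j, ∀ t < N j, dist (T^[t] (y j)) (T^[t] (y (j + 1))) ≤ C / 2 / 2 ^ j) {j t : ℕ}
    (ht : t < N j) : dist (T^[t] (y j)) (T^[t] x) ≤ C / 2 ^ j := by
  have h1 : ∀ n, dist (T^[t] (y (j + n))) (T^[t] (y (j + (n + 1)))) ≤ C / 2 ^ j / 2 / 2 ^ n := by
    intro n
    refine (h (j + n) t (ht.trans_le (hN (Nat.le_add_right _ _)))).trans (le_of_eq ?_)
    rw [pow_add]; field_simp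
  have h2 : Tendsto (fun n => T^[t] (y (j + n))) atTop (𝓝 (T^[t] x)) := by
    have := ((hT.iterate t).tendsto x).comp hx
    simpa only [Function.comp_def, add_comm] using (tendsto_add_atTop_iff_nat j).2 this
  simpa using dist_le_of_le_geometric_two_of_tendsto₀ h1 h2

/-- Iterates the extension with geometrically decreasing errors. The second clause holds because
each stage uses only finitely many targets; it makes the point depend continuously on the sequence.
-/
theorem HasSAPS.exists_follow [CompleteSpace X] (h : HasSAPS T) (hT : Continuous T) (x₀ : X) {r : ℝ}
    (hr : 0 < r) :
    ∃ F : (ℕ → {m : BLip X →ᵇ ℝ // IsApproximable T m}) → X,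
      (∀ m, dist (F m) x₀ ≤ r) ∧
      (∀ m m' j, (∀ i ≤ j, m i = m' i) → dist (F m) (F m') ≤ r / 2 ^ j) ∧
      ∀ m, ∃ N : ℕ → ℕ, StrictMono N ∧ 0 < N 0 ∧ ∀ j,
        ‖avg T (N j) (F m) - m j‖ ≤ r / 2 ^ j ∧
        ∀ i, N j ≤ i → i ≤ N (j + 1) → ‖avg T i (F m) - m (j + 1)‖ ≤
          ‖(m j : BLip X →ᵇ ℝ) - m (j + 1)‖ + r / 2 ^ j := by
  let ε : ℕ → ℝ := fun j => r / 2 / 2 / 2 ^ j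
  have hε (j) : 0 < ε j := by positivity
  choose L hL using fun (j : ℕ) (m : {m : BLip X →ᵇ ℝ // IsApproximable T m}) =>
    h.exists_extension m.2 (hε j)
  -- The extension step becomes a total function, with junk value `p`, so that a single choice
  -- serves all target sequences.
  have hL' : ∀ (j : ℕ) (m : {m : BLip X →ᵇ ℝ // IsApproximable T m}) (M : ℕ) (p : X × ℕ),
      ∃ q : X × ℕ, L j m ≤ p.2 → 0 < p.2 → M ≤ q.2 ∧ p.2 < q.2 ∧
      (∀ t < p.2, dist (T^[t] p.1) (T^[t] q.1) < ε j) ∧ ‖avg T q.2 q.1 - m‖ ≤ ε j ∧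
      ∀ i, p.2 ≤ i → i ≤ q.2 → ‖avg T i q.1 - m‖ ≤ ‖avg T p.2 p.1 - m‖ + ε j := by
    intro j m M p
    by_cases hp : L j m ≤ p.2 ∧ 0 < p.2
    · obtain ⟨z, N', hz⟩ := hL j m p.1 p.2 M hp.1 hp.2
      exact ⟨(z, N'), fun _ _ => hz⟩
    · exact ⟨p, fun h1 h2 => absurd ⟨h1, h2⟩ hp⟩
  choose step hstep using hL'
  -- Each stage is made long enough for the next one to start, so `st m j` depends only on `m 0, …,
  -- m j`.
  let st : (ℕ → {m : BLip X →ᵇ ℝ // IsApproximable T m}) → ℕ → X × ℕ := fun m j =>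
    Nat.rec (x₀, max 1 (L 0 (m 0))) (fun j p => step j (m j) (L (j + 1) (m (j + 1))) p) j
  have st_succ (m) (j : ℕ) :
    st m (j + 1) = step j (m j) (L (j + 1) (m (j + 1))) (st m j) := rfl
  have hLst (m) : ∀ j, L j (m j) ≤ (st m j).2 ∧ 0 < (st m j).2 := by
    intro j
    induction j with
    | zero => exact ⟨le_max_right _ _, lt_of_lt_of_le one_pos (le_max_left _ _)⟩
    | succ j ih =>
      have := hstep j (m j) (L (j + 1) (m (j + 1))) (st m j) ih.1 ih.2
      rw [← st_succ] at this
      exact ⟨this.1, ih.2.trans this.2.1⟩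
  have hst (m) (j : ℕ) : (st m j).2 < (st m (j + 1)).2 ∧
      (∀ t < (st m j).2, dist (T^[t] (st m j).1) (T^[t] (st m (j + 1)).1) < ε j) ∧
      ‖avg T (st m (j + 1)).2 (st m (j + 1)).1 - m j‖ ≤ ε j ∧
      ∀ i, (st m j).2 ≤ i → i ≤ (st m (j + 1)).2 → ‖avg T i (st m (j + 1)).1 - m j‖ ≤
        ‖avg T (st m j).2 (st m j).1 - m j‖ + ε j := by
    have := hstep j (m j) (L (j + 1) (m (j + 1))) (st m j) (hLst m j).1 (hLst m j).2
    rw [← st_succ] at this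
    exact this.2
  have hmono (m) : StrictMono fun j => (st m j).2 := strictMono_nat_of_lt_succ fun j => (hst m j).1
  have hcauchy (m) : CauchySeq fun j => (st m j).1 :=
    cauchySeq_of_le_geometric_two (C := r / 2) fun j => ((hst m j).2.1 0 (hLst m j).2).le
  choose F hF using fun m => cauchySeq_tendsto_of_complete (hcauchy m)
  have hdist (m) {j t : ℕ} (ht : t < (st m j).2) :
      dist (T^[t] (st m j).1) (T^[t] (F m)) ≤ r / 2 / 2 ^ j :=
    iterate_dist_limit_le hT (hmono m).monotone (hF m) (fun j t ht => ((hst m j).2.1 t ht).le) ht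
  have havg (m) {i j : ℕ} (hi : i ≤ (st m j).2) :
      ‖avg T i (F m) - avg T i (st m j).1‖ ≤ r / 2 / 2 ^ j := by
    rw [norm_sub_rev]
    exact norm_avg_sub_le (by positivity) fun t ht => hdist m (ht.trans_le hi)
  refine ⟨F, fun m => ?_, fun m m' j hj => ?_, fun m => ?_⟩
  · have := hdist m (j := 0) (t := 0) (hLst m 0).2
    rw [dist_comm]
    simp only [pow_zero, div_one, Function.iterate_zero, id] at this
    exact this.trans (by linarith)
  · have heq : ∀ k ≤ j, st m k = st m' k := by
      intro k
      induction k with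
      | zero => intro _; simp [st, hj 0 (Nat.zero_le _)]
      | succ k ih =>
        intro hk
        rw [st_succ, st_succ, ih (by omega), hj k (by omega), hj (k + 1) hk]
    have h1 := hdist m (j := j) (t := 0) (hLst m j).2
    have h2 := hdist m' (j := j) (t := 0) (hLst m' j).2
    rw [heq j le_rfl] at h1
    simp only [Function.iterate_zero, id] at h1 h2
    have h3 := dist_triangle_left (F m) (F m') (st m' j).1
    have : r / 2 / 2 ^ j + r / 2 / 2 ^ j = r / 2 ^ j := by ring
    linarith
  -- The shift by one: it is stage `j + 1` that ends near `m j`.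
  · refine ⟨fun j => (st m (j + 1)).2, fun a b hab => hmono m (Nat.succ_lt_succ hab), (hLst m 1).2,
      fun j => ?_⟩
    have hp : 0 < r / 2 ^ j := by positivity
    have t1 : r / 2 / 2 ^ (j + 1) = r / 2 ^ j / 4 := by rw [pow_succ]; field_simp; norm_num
    have t2 : r / 2 / 2 ^ (j + 1 + 1) = r / 2 ^ j / 8 := by
      rw [pow_succ, pow_succ]; field_simp; norm_num
    have t3 : ε j = r / 2 ^ j / 4 := by simp only [ε]; field_simp; norm_num
    have t4 : ε (j + 1) = r / 2 ^ j / 8 := by simp only [ε]; rw [pow_succ]; field_simp; norm_num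
    have h1 := (hst m j).2.2.1
    constructor
    · have h2 := havg m (j := j + 1) (le_refl (st m (j + 1)).2)
      have h3 := norm_sub_le_norm_sub_add_norm_sub (avg T (st m (j + 1)).2 (F m))
        (avg T (st m (j + 1)).2 (st m (j + 1)).1) (m j)
      linarith
    · intro i hi1 hi2
      have h2 := havg m (j := j + 1 + 1) hi2
      have h3 := (hst m (j + 1)).2.2.2 i hi1 hi2
      have h4 := norm_sub_le_norm_sub_add_norm_sub (avg T i (F m))
        (avg T i (st m (j + 1 + 1)).1) (m (j + 1))
      have h5 := norm_sub_le_norm_sub_add_norm_sub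
        (avg T (st m (j + 1)).2 (st m (j + 1)).1) (m j : BLip X →ᵇ ℝ) (m (j + 1))
      linarith

end Follow

/-! ### Low levels of the Borel hierarchy -/

section Borel

variable {X : Type*} [TopologicalSpace X]

lemma IsSigma0.isOpen_of_one {A : Set X} (h : IsSigma0 1 A) : IsOpen A := by
  cases h with
  | isOpen _ hA => exact hA
  | iUnion _ m A hm _ => have := hm 0; omega

lemma IsSigma0.exists_isClosed_of_two {A : Set X} (h : IsSigma0 2 A) :
    ∃ F : ℕ → Set X, (∀ i, IsClosed (F i)) ∧ A = ⋃ i, F i := by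
  cases h with
  | iUnion _ m A hm hA =>
    refine ⟨A, fun i => ?_, rfl⟩
    have := hA i
    rw [show m i = 1 by have := hm i; omega] at this
    exact isOpen_compl_iff.1 this.isOpen_of_one

lemma IsSigma0.isGδ_compl_of_two {A : Set X} (h : IsSigma0 2 A) : IsGδ Aᶜ := by
  obtain ⟨F, hF, rfl⟩ := h.exists_isClosed_of_two
  rw [compl_iUnion]
  exact IsGδ.iInter_of_isOpen fun i => (hF i).isOpen_compl

lemma IsSigma0.exists_isGδ_of_three [TopologicalSpace.PseudoMetrizableSpace X] {A : Set X}
    (h : IsSigma0 3 A) : ∃ G : ℕ → Set X, (∀ i, IsGδ (G i)) ∧ A = ⋃ i, G i := by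
  let _ := TopologicalSpace.pseudoMetrizableSpacePseudoMetric X
  cases h with
  | iUnion _ m A hm hA =>
    refine ⟨A, fun i => ?_, rfl⟩
    have h := hA i
    obtain h1 | h2 : m i = 1 ∨ m i = 2 := by have := hm i; omega
    · rw [h1] at h
      exact (isOpen_compl_iff.1 h.isOpen_of_one).isGδ
    · rw [h2] at h
      simpa using h.isGδ_compl_of_two

lemma isPi0_two_of_isGδ {A : Set X} (h : IsGδ A) : IsPi0 2 A := by
  obtain ⟨U, hU, rfl⟩ := h.eq_iInter_nat
  rw [IsPi0, compl_iInter]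
  refine IsSigma0.iUnion 2 (fun _ => 1) _ (fun _ => by simp) fun i => ?_
  rw [compl_compl]
  exact IsSigma0.isOpen _ (hU i)

lemma isPi0_three_iInter_iUnion {A : ℕ → ℕ → Set X} (h : ∀ i j, IsClosed (A i j)) :
    IsPi0 3 (⋂ i, ⋃ j, A i j) := by
  rw [IsPi0, compl_iInter]
  refine IsSigma0.iUnion 3 (fun _ => 2) _ (fun _ => by simp) fun i => ?_
  rw [compl_compl]
  exact IsSigma0.iUnion 2 (fun _ => 1) _ (fun _ => by simp) fun j =>
    IsSigma0.isOpen _ (h i j).isOpen_compl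

end Borel

/-! ### Sequences of natural numbers tending to infinity -/

section Baire

lemma exists_cylinder_subset_of_isOpen {U : Set (ℕ → ℕ)} (hU : IsOpen U) {γ : ℕ → ℕ} (hγ : γ ∈ U) :
    ∃ l, ∀ β : ℕ → ℕ, (∀ n < l, β n = γ n) → β ∈ U := by
  obtain ⟨I, u, hu, hIU⟩ := isOpen_pi_iff.1 hU γ hγ
  refine ⟨I.sup id + 1, fun β hβ => hIU fun i hi => ?_⟩
  rw [hβ i (Nat.lt_succ_of_le (Finset.le_sup (f := id) hi))]
  exact (hu i hi).2

lemma isGδ_dense_frequently_zero {J : Set ℕ} (hJ : J.Infinite) :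
    IsGδ {γ : ℕ → ℕ | ∀ n, ∃ j ∈ J, n ≤ j ∧ γ j = 0} ∧
      Dense {γ : ℕ → ℕ | ∀ n, ∃ j ∈ J, n ≤ j ∧ γ j = 0} := by
  constructor
  · have : {γ : ℕ → ℕ | ∀ n, ∃ j ∈ J, n ≤ j ∧ γ j = 0} =
        ⋂ n, ⋃ j ∈ {j | j ∈ J ∧ n ≤ j}, {γ : ℕ → ℕ | γ j = 0} := by
      ext γ; simp [and_assoc]
    rw [this]
    exact IsGδ.iInter_of_isOpen fun n => isOpen_biUnion fun j _ =>
      (isOpen_discrete {0}).preimage (continuous_apply j)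
  · rw [dense_iff_inter_open]
    rintro U hU ⟨γ, hγ⟩
    obtain ⟨l, hl⟩ := exists_cylinder_subset_of_isOpen hU hγ
    refine ⟨fun n => if n < l then γ n else 0, hl _ fun n hn => by simp [hn], fun n => ?_⟩
    obtain ⟨j, hj, hn⟩ := hJ.exists_gt (max n l)
    exact ⟨j, hj, by omega, by simp; omega⟩

/-- A `Gδ` set of sequences that avoids every sequence with the value `m` infinitely often along `J`
is disjoint from a basic set of sequences bounded below by `m`. -/
lemma exists_cylinder_disjoint {J : Set ℕ} (hJ : J.Infinite) {G : Set (ℕ → ℕ)} (hG : IsGδ G) (m : ℕ)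
    (hdisj : ∀ α ∈ G, ¬ ∀ n, ∃ j ∈ J, n ≤ j ∧ α j = m) (α : ℕ → ℕ) (l : ℕ) :
    ∃ (α' : ℕ → ℕ) (l' : ℕ), l < l' ∧ (∀ n < l, α' n = α n) ∧ (∀ n, l ≤ n → m ≤ α' n) ∧
      ∀ β : ℕ → ℕ, (∀ n < l', β n = α' n) → (∀ n, l' ≤ n → m ≤ β n) → β ∉ G := by
  -- Freezing the first `l` values and raising the others by `m` identifies all sequences with the
  -- admissible ones, and turns the value `0` into `m`. If the preimage of `G` were dense, Baire
  -- would give a point of `G` with the value `m` infinitely often along `J`.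
  let g : (ℕ → ℕ) → ℕ → ℕ := fun γ n => if n < l then α n else γ n + m
  have hg : Continuous g := by
    refine continuous_pi fun n => ?_
    by_cases hn : n < l
    · simp only [g, hn, if_true]; exact continuous_const
    · simp only [g, hn, if_false]; exact (continuous_apply n).add continuous_const
  obtain ⟨h1, h2⟩ := isGδ_dense_frequently_zero hJ
  have hnd : ¬ Dense (g ⁻¹' G) := by
    intro hd
    obtain ⟨γ, hγG, hγ⟩ := (hd.inter_of_Gδ (hG.preimage hg) h1 h2).nonempty
    refine hdisj _ hγG fun n => ?_
    obtain ⟨j, hj, hn, h0⟩ := hγ (max n l)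
    exact ⟨j, hj, by omega, by simp [g, h0]; omega⟩
  rw [dense_iff_inter_open] at hnd
  push Not at hnd
  obtain ⟨U, hU, ⟨γ, hγ⟩, hUG⟩ := hnd
  obtain ⟨k, hk⟩ := exists_cylinder_subset_of_isOpen hU hγ
  refine ⟨g γ, max k l + 1, by omega, fun n hn => by simp [g, hn],
    fun n hn => by simp [g, not_lt.2 hn], fun β hβ hβm hβG => ?_⟩
  have hβ' : β = g fun n => if n < k then γ n else β n - m := by
    funext n
    by_cases hn : n < l
    · rw [hβ n (by omega)]; simp [g, hn]
    · by_cases hn' : n < k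
      · rw [hβ n (by omega)]; simp [g, hn, hn']
      · have hm : m ≤ β n := by
          by_cases hn'' : n < max k l + 1
          · rw [hβ n hn'']; simp [g, hn]
          · exact hβm n (by omega)
        simp only [g, hn, hn', if_false]; omega
  have : (fun n => if n < k then γ n else β n - m) ∈ U ∩ g ⁻¹' G :=
    ⟨hk _ fun n hn => by simp [hn], by rw [mem_preimage, ← hβ']; exact hβG⟩
  rw [hUG] at this
  exact this

/-- A countable union of `Gδ` sets of sequences that contains every sequence tending to infinity
contains a sequence with a value taken infinitely often along `J`. -/
theorem exists_mem_iUnion_isGδ {J : Set ℕ} (hJ : J.Infinite) {G : ℕ → Set (ℕ → ℕ)}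
    (hG : ∀ i, IsGδ (G i)) (h : ∀ α : ℕ → ℕ, Tendsto α atTop atTop → α ∈ ⋃ i, G i) :
    ∃ α ∈ ⋃ i, G i, ∃ m, ∀ n, ∃ j ∈ J, n ≤ j ∧ α j = m := by
  by_contra! hcon
  have hstep := fun (m : ℕ) (p : (ℕ → ℕ) × ℕ) => exists_cylinder_disjoint hJ (hG m) m
    (fun α hα hm => by
      obtain ⟨n, hn⟩ := hcon α (mem_iUnion_of_mem m hα) m
      obtain ⟨j, hj, hnj, hjm⟩ := hm n
      exact hn j hj hnj hjm) p.1 p.2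
  choose a l hl hagree hge hG' using hstep
  -- Diagonalisation: stage `m` fixes a longer prefix that forces the limit out of `G m`, provided
  -- all later values are at least `m`. The limit tends to infinity but lies in no `G m`.
  let st : ℕ → (ℕ → ℕ) × ℕ := fun j => Nat.rec (fun _ => 0, 0) (fun m p => (a m p, l m p)) j
  have hmono : StrictMono fun m => (st m).2 := strictMono_nat_of_lt_succ fun m => hl m (st m)
  have hag : ∀ m k, ∀ n < (st m).2, (st (m + k)).1 n = (st m).1 n := by
    intro m k
    induction k with
    | zero => intro n _; rfl
    | succ k ih =>
      intro n hn
      rw [← ih n hn]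
      exact hagree (m + k) (st (m + k)) n (hn.trans_le (hmono.monotone (Nat.le_add_right _ _)))
  let α : ℕ → ℕ := fun n => (st (n + 1)).1 n
  have hid : ∀ n, n < (st (n + 1)).2 := fun n => hmono.le_apply (x := n + 1)
  have hα : ∀ m, ∀ n < (st m).2, α n = (st m).1 n := by
    intro m n hn
    rcases le_total m (n + 1) with h | h
    · obtain ⟨k, hk⟩ := Nat.exists_eq_add_of_le h
      simp only [α, hk]
      exact hag m k n hn
    · obtain ⟨k, rfl⟩ := Nat.exists_eq_add_of_le h
      exact (hag (n + 1) k n (hid n)).symm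
  have hαge : ∀ m n, (st m).2 ≤ n → m ≤ α n := by
    intro m n hmn
    have hex : ∃ k, n < (st k).2 := ⟨n + 1, hid n⟩
    classical
    obtain ⟨k, hk⟩ : ∃ k, Nat.find hex = k + 1 := Nat.exists_eq_succ_of_ne_zero (by
      intro h0
      have := Nat.find_spec hex
      rw [h0] at this
      simp [st] at this)
    have h1 : n < (st (k + 1)).2 := hk ▸ Nat.find_spec hex
    have h2 : (st k).2 ≤ n := not_lt.1 (Nat.find_min hex (by omega))
    have h3 : m < k + 1 := hmono.lt_iff_lt.1 (hmn.trans_lt h1)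
    rw [hα (k + 1) n h1]
    have := hge k (st k) n h2
    exact le_trans (by omega) this
  have htend : Tendsto α atTop atTop :=
    tendsto_atTop.2 fun m => (eventually_ge_atTop (st m).2).mono fun n hn => hαge m n hn
  obtain ⟨m, hm⟩ := mem_iUnion.1 (h α htend)
  exact hG' m (st m) α (fun n hn => hα (m + 1) n hn)
    (fun n hn => (Nat.le_succ m).trans (hαge (m + 1) n hn)) hm

end Baire

/-! ### Sequences with vanishing steps in connected sets -/

section Chains

variable {E : Type*} [PseudoMetricSpace E]

/-- Being joined by an `ε`-chain is a transitive relation that holds near the diagonal. The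
condition `0 < l` lets chains be concatenated at strictly increasing times. -/
lemma exists_path_of_isPreconnected {W : Set E} (hW : IsPreconnected W) {ε : ℝ} (hε : 0 < ε)
    {a b : E} (ha : a ∈ W) (hb : b ∈ W) :
    ∃ (l : ℕ) (p : ℕ → E), 0 < l ∧ p 0 = a ∧ p l = b ∧ (∀ i, p i ∈ W) ∧
      ∀ i, dist (p i) (p (i + 1)) < ε := by
  refine hW.induction₂' (fun a b => ∃ (l : ℕ) (p : ℕ → E), 0 < l ∧ p 0 = a ∧ p l = b ∧
      (∀ i, p i ∈ W) ∧ ∀ i, dist (p i) (p (i + 1)) < ε) ?_ ?_ ha hb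
  · intro x hx
    have step (u v : E) (hu : u ∈ W) (hv : v ∈ W) (huv : dist u v < ε) :
        ∃ (l : ℕ) (p : ℕ → E), 0 < l ∧ p 0 = u ∧ p l = v ∧ (∀ i, p i ∈ W) ∧
          ∀ i, dist (p i) (p (i + 1)) < ε := by
      refine ⟨1, fun i => if i = 0 then u else v, one_pos, rfl, rfl, fun i => ?_, fun i => ?_⟩
      · dsimp only; split_ifs <;> assumption
      · cases i with
        | zero => simpa using huv
        | succ i => simpa using hε
    filter_upwards [self_mem_nhdsWithin, mem_nhdsWithin_of_mem_nhds (Metric.ball_mem_nhds x hε)]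
      with y hy hxy
    exact ⟨step x y hx hy (by rwa [dist_comm]), step y x hy hx hxy⟩
  · rintro x y z - - - ⟨l, p, hl, hp0, hpl, hpW, hpd⟩ ⟨l', p', hl', hp0', hpl', hpW', hpd'⟩
    refine ⟨l + l', fun i => if i < l then p i else p' (i - l), by omega, by simp [hl, hp0],
      by simp [hpl'], fun i => ?_, fun i => ?_⟩
    · dsimp only; split_ifs <;> simp [hpW, hpW']
    · dsimp only
      rcases lt_trichotomy (i + 1) l with h | h | h
      · rw [if_pos (by omega), if_pos h]; exact hpd i
      · rw [if_pos (by omega), if_neg (by omega), h, Nat.sub_self, hp0', ← hpl, ← h]; exact hpd i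
      · rw [if_neg (by omega), if_neg (by omega), show i + 1 - l = i - l + 1 by omega]
        exact hpd' _

/-- In a preconnected set, any sequence is a subsequence of one with vanishing steps. -/
lemma exists_slow_sequence {W : Set E} (hW : IsPreconnected W) {a : ℕ → E} (ha : ∀ n, a n ∈ W) :
    ∃ (u : ℕ → E) (N : ℕ → ℕ), StrictMono N ∧ (∀ n, u (N n) = a n) ∧ (∀ j, u j ∈ W) ∧
      Tendsto (fun j => dist (u j) (u (j + 1))) atTop (𝓝 0) := by
  choose l p hl hp0 hpl hpW hpd using fun n : ℕ =>
    exists_path_of_isPreconnected hW (Nat.one_div_pos_of_nat (α := ℝ) (n := n)) (ha n) (ha (n + 1))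
  let N : ℕ → ℕ := fun n => ∑ i ∈ Finset.range n, l i
  have hNs (n) : N (n + 1) = N n + l n := Finset.sum_range_succ _ _
  have hN : StrictMono N := strictMono_nat_of_lt_succ fun n => by rw [hNs]; have := hl n; omega
  have hN0 : N 0 = 0 := rfl
  have hblock (j : ℕ) : ∃ n, N n ≤ j ∧ j < N (n + 1) := by
    induction j with
    | zero => exact ⟨0, le_rfl, by rw [hNs, hN0]; have := hl 0; omega⟩
    | succ j ih =>
      obtain ⟨n, h1, h2⟩ := ih
      rcases Nat.lt_or_ge (j + 1) (N (n + 1)) with h | h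
      · exact ⟨n, by omega, h⟩
      · exact ⟨n + 1, h, by rw [hNs (n + 1)]; have := hl (n + 1); omega⟩
  choose b hb1 hb2 using hblock
  have hbu {j n : ℕ} (h1 : N n ≤ j) (h2 : j < N (n + 1)) : b j = n := by
    have h3 := hN.lt_iff_lt.1 ((hb1 j).trans_lt h2)
    have h4 := hN.lt_iff_lt.1 (h1.trans_lt (hb2 j))
    omega
  let u : ℕ → E := fun j => p (b j) (j - N (b j))
  have huN (n) : u (N n) = a n := by
    have := hbu (le_refl (N n)) (hN (Nat.lt_succ_self n))
    simp only [u, this, Nat.sub_self, hp0]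
  refine ⟨u, N, hN, huN, fun j => hpW _ _, ?_⟩
  have hbt : Tendsto b atTop atTop := tendsto_atTop.2 fun n => by
    filter_upwards [eventually_ge_atTop (N n)] with j hj
    have := hN.lt_iff_lt.1 (hj.trans_lt (hb2 j))
    omega
  refine squeeze_zero (fun _ => dist_nonneg) (fun j => ?_)
    ((tendsto_one_div_add_atTop_nhds_zero_nat (𝕜 := ℝ)).comp hbt)
  have h1 := hb1 j
  have h2 := hb2 j
  -- At the end of a leg, the next one starts where this one arrives, so the step still belongs to
  -- leg `b j`.
  have key : u (j + 1) = p (b j) (j - N (b j) + 1) := by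
    rcases Nat.lt_or_ge (j + 1) (N (b j + 1)) with h | h
    · have := hbu (show N (b j) ≤ j + 1 by omega) h
      simp only [u, this]
      congr 1; omega
    · have h3 : j + 1 = N (b j + 1) := by omega
      rw [h3, huN, ← hpl]
      congr 1
      rw [hNs] at h3; omega
  rw [key]
  exact (hpd _ _).le

/-- A separable preconnected set contains a sequence with vanishing steps that returns to a given
point infinitely often and accumulates at every point of the set. -/
lemma exists_slow_dense_sequence {W : Set E} (hW : IsPreconnected W)
    (hs : TopologicalSpace.IsSeparable W) {v : E} (hv : v ∈ W) :
    ∃ u : ℕ → E, (∀ j, u j ∈ W) ∧ {j | u j = v}.Infinite ∧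
      Tendsto (fun j => dist (u j) (u (j + 1))) atTop (𝓝 0) ∧
      ∀ w ∈ W, MapClusterPt w atTop u := by
  have : Nonempty W := ⟨⟨v, hv⟩⟩
  have : TopologicalSpace.SeparableSpace W := hs.separableSpace
  let d : ℕ → W := TopologicalSpace.denseSeq W
  -- Even terms return to `v`; odd terms list the dense sequence with every entry repeated
  -- infinitely often.
  let a : ℕ → E := fun n => if Even n then v else d (Nat.unpair (n / 2)).1
  obtain ⟨u, N, hN, huN, huW, hut⟩ := exists_slow_sequence hW (a := a) (fun n => by
    dsimp only [a]; split_ifs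
    exacts [hv, (d _).2])
  refine ⟨u, huW, ?_, hut, fun w hw => ?_⟩
  · refine (Set.infinite_range_of_injective (f := fun n => N (2 * n)) fun n k h => ?_).mono ?_
    · have := hN.injective h; omega
    · rintro _ ⟨n, rfl⟩
      simp [huN, a]
  · rw [mapClusterPt_iff_frequently]
    intro U hU
    rw [frequently_atTop]
    intro n
    obtain ⟨O, hOU, hO, hwO⟩ := mem_nhds_iff.1 hU
    obtain ⟨k, hk⟩ := (TopologicalSpace.denseRange_denseSeq W).exists_mem_open
      (hO.preimage continuous_subtype_val) ⟨⟨w, hw⟩, hwO⟩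
    refine ⟨N (2 * Nat.pair k n + 1), ?_, hOU ?_⟩
    · have h1 : 2 * Nat.pair k n + 1 ≤ N (2 * Nat.pair k n + 1) := hN.le_apply
      have h2 := Nat.right_le_pair k n
      omega
    · have h1 : ¬ Even (2 * Nat.pair k n + 1) := by simp
      have h2 : (2 * Nat.pair k n + 1) / 2 = Nat.pair k n := by omega
      rw [huN]
      simp only [a, h1, if_false, h2, Nat.unpair_pair]
      exact hk

end Chains

/-! ### Convex combinations of invariant measures -/

section Mixtures

variable {X : Type*} [MeasurableSpace X]

/-- The convex combination `(1 - t) μ + t ν`. -/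
def mix (μ ν : ProbabilityMeasure X) (t : Icc (0 : ℝ) 1) : ProbabilityMeasure X :=
  ⟨ENNReal.ofReal (1 - t) • (μ : Measure X) + ENNReal.ofReal t • (ν : Measure X), ⟨by
    rw [Measure.add_apply, Measure.smul_apply, Measure.smul_apply, measure_univ, measure_univ,
      smul_eq_mul, smul_eq_mul, mul_one, mul_one, ← ENNReal.ofReal_add (by linarith [t.2.2]) t.2.1]
    simp⟩⟩

lemma mix_mem_invMeasures {T : X → X} {μ ν : ProbabilityMeasure X} (hμ : μ ∈ invMeasures T)
    (hν : ν ∈ invMeasures T) (t : Icc (0 : ℝ) 1) : mix μ ν t ∈ invMeasures T := by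
  have hT : Measurable T := MeasurePreserving.measurable hμ
  refine ⟨hT, ?_⟩
  change Measure.map T (ENNReal.ofReal (1 - t) • (μ : Measure X) + ENNReal.ofReal t • (ν : Measure X))
    = ENNReal.ofReal (1 - t) • (μ : Measure X) + ENNReal.ofReal t • (ν : Measure X)
  rw [Measure.map_add _ _ hT, Measure.map_smul, Measure.map_smul, MeasurePreserving.map_eq hμ,
    MeasurePreserving.map_eq hν]

variable [MetricSpace X] [BorelSpace X] [TopologicalSpace.SeparableSpace X]

lemma embed_mix (μ ν : ProbabilityMeasure X) (t : Icc (0 : ℝ) 1) :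
    embed (mix μ ν t) = (1 - t : ℝ) • embed μ + (t : ℝ) • embed ν := by
  have h : ((mix μ ν t : ProbabilityMeasure X) : Measure X) =
    ENNReal.ofReal (1 - t) • (μ : Measure X) + ENNReal.ofReal t • (ν : Measure X) := rfl
  rw [embed, h, integral_add_measure ((integrable_evalPt _).smul_measure (by simp))
    ((integrable_evalPt _).smul_measure (by simp)), integral_smul_measure, integral_smul_measure,
    ENNReal.toReal_ofReal (by linarith [t.2.2]), ENNReal.toReal_ofReal t.2.1]
  rfl

lemma continuous_mix (μ ν : ProbabilityMeasure X) : Continuous (mix μ ν) := by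
  rw [isInducing_embed.continuous_iff]
  have : embed ∘ mix μ ν = fun t : Icc (0 : ℝ) 1 => (1 - t : ℝ) • embed μ + (t : ℝ) • embed ν :=
    funext fun t => embed_mix μ ν t
  rw [this]
  fun_prop

/-- Some point of `V` is a limit of invariant measures outside `V`. -/
lemma exists_tendsto_embed_of_notMem {T : X → X} {V : Set (ProbabilityMeasure X)} (hV : IsClosed V)
    (hVT : V ⊆ invMeasures T) {v w : ProbabilityMeasure X} (hv : v ∈ V) (hw : w ∈ invMeasures T \ V) :
    ∃ v₀ ∈ V, ∃ m : ℕ → ProbabilityMeasure X, (∀ k, m k ∈ invMeasures T \ V) ∧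
      Tendsto (fun k => embed (m k)) atTop (𝓝 (embed v₀)) := by
  have hc : IsCompact (mix v w ⁻¹' V) := (hV.preimage (continuous_mix v w)).isCompact
  have mix_zero : mix v w 0 = v := by ext1; simp [mix]
  have mix_one : mix v w 1 = w := by ext1; simp [mix]
  -- The last parameter at which the segment from `v` to `w` is in `V`; later points of the segment
  -- are outside `V` and converge to this one.
  obtain ⟨t, ht, hmax⟩ := hc.exists_isGreatest ⟨0, by rwa [mem_preimage, mix_zero]⟩
  have ht1 : (t : ℝ) < 1 := lt_of_le_of_ne t.2.2 fun h => hw.2 <| by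
    have : t = 1 := Subtype.ext h
    rwa [this, mem_preimage, mix_one] at ht
  have hlim : Tendsto (fun k : ℕ => (t : ℝ) + (1 - t) * (1 / ((k : ℝ) + 1))) atTop (𝓝 t) := by
    simpa using ((tendsto_one_div_add_atTop_nhds_zero_nat (𝕜 := ℝ)).const_mul
      (1 - (t : ℝ))).const_add (t : ℝ)
  have hmem (k : ℕ) : (t : ℝ) + (1 - t) * (1 / ((k : ℝ) + 1)) ∈ Icc (0 : ℝ) 1 := by
    have h0 := t.2.1
    have h1 : 0 ≤ 1 / ((k : ℝ) + 1) := by positivity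
    have h2 : 1 / ((k : ℝ) + 1) ≤ 1 := by
      rw [div_le_one (by positivity)]; linarith [(Nat.cast_nonneg k : (0 : ℝ) ≤ k)]
    constructor <;> nlinarith
  refine ⟨mix v w t, ht, fun k => mix v w ⟨_, hmem k⟩, fun k => ⟨mix_mem_invMeasures (hVT hv) hw.1 _,
    fun hk => ?_⟩, ?_⟩
  · have h1 : (t : ℝ) + (1 - t) * (1 / ((k : ℝ) + 1)) ≤ t := hmax hk
    have h2 : 0 < (1 - t) * (1 / ((k : ℝ) + 1)) := mul_pos (by linarith) (by positivity)
    linarith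
  · refine ((continuous_embed.comp (continuous_mix v w)).tendsto t).comp ?_
    rw [tendsto_subtype_rng]
    exact hlim

end Mixtures

/-! ### Density and complexity of the sets of generic points -/

section Main

lemma tendsto_div_two_pow (r : ℝ) : Tendsto (fun j : ℕ => r / 2 ^ j) atTop (𝓝 0) := by
  have := (tendsto_pow_atTop_nhds_zero_of_lt_one (r := (1 / 2 : ℝ)) (by norm_num)
    (by norm_num)).const_mul r
  simpa [div_eq_mul_inv] using this

variable {X : Type*} [MetricSpace X] [MeasurableSpace X] [BorelSpace X]
  [TopologicalSpace.SeparableSpace X] {T : X → X}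

/-- The averages along the orbit of `x` follow the sequence `m`. -/
def Follows (T : X → X) (r : ℝ) (x : X) (m : ℕ → BLip X →ᵇ ℝ) : Prop :=
  ∃ N : ℕ → ℕ, StrictMono N ∧ 0 < N 0 ∧ ∀ j, ‖avg T (N j) x - m j‖ ≤ r / 2 ^ j ∧
    ∀ i, N j ≤ i → i ≤ N (j + 1) → ‖avg T i x - m (j + 1)‖ ≤ ‖m j - m (j + 1)‖ + r / 2 ^ j

lemma isApproximable_embed (hT : Continuous T) {μ : ProbabilityMeasure X} (hμ : μ ∈ invMeasures T) :
    IsApproximable T (embed μ) := fun _ hn => exists_tendsto_avg hT hμ hn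

lemma embed_emp_succPNat (x : X) (n : ℕ) : embed (emp T x n.succPNat) = avg T (n + 1) x :=
  embed_emp T x n.succPNat

lemma mem_limitMeasures_iff {x : X} {μ : ProbabilityMeasure X} :
    μ ∈ limitMeasures T x ↔
      ∀ ε > 0, ∀ n : ℕ, ∃ i ≥ n, dist (avg T (i + 1) x) (embed μ) < ε := by
  have hb : (𝓝 μ).HasBasis (fun ε : ℝ => 0 < ε) fun ε => embed ⁻¹' Metric.ball (embed μ) ε := by
    rw [isInducing_embed.nhds_eq_comap]
    exact Metric.nhds_basis_ball.comap _
  change MapClusterPt _ _ _ ↔ _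
  rw [hb.mapClusterPt_iff_frequently]
  simp only [frequently_atTop, mem_preimage, Metric.mem_ball, embed_emp_succPNat]

lemma mem_genericPts_iff {x : X} {μ : ProbabilityMeasure X} :
    x ∈ genericPts T μ ↔ Tendsto (fun n : ℕ => avg T (n + 1) x) atTop (𝓝 (embed μ)) := by
  change Tendsto _ _ _ ↔ _
  rw [isInducing_embed.tendsto_nhds_iff]
  simp only [Function.comp_def, embed_emp_succPNat]

/-- The points whose empirical measures accumulate at all points of `V` and approach `V`. -/
def strongG (T : X → X) (V : Set (ProbabilityMeasure X)) : Set X :=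
  {x | V ⊆ limitMeasures T x ∧
    ∀ ε > 0, ∀ᶠ n in atTop, ∃ v ∈ V, dist (avg T (n + 1) x) (embed v) < ε}

lemma strongG_subset_lowerG {V : Set (ProbabilityMeasure X)} (hV : IsClosed V) :
    strongG T V ⊆ lowerG T V := by
  intro x hx μ hμ
  rw [← hV.closure_eq, isInducing_embed.closure_eq_preimage_closure_image, mem_preimage,
    Metric.mem_closure_iff]
  intro ε hε
  obtain ⟨n, hn⟩ := eventually_atTop.1 (hx.2 (ε / 2) (by positivity))
  obtain ⟨i, hi, hd⟩ := mem_limitMeasures_iff.1 hμ (ε / 2) (by positivity) n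
  obtain ⟨v, hv, hvd⟩ := hn i hi
  refine ⟨embed v, mem_image_of_mem _ hv, ?_⟩
  have := dist_triangle_left (embed μ) (embed v) (avg T (i + 1) x)
  linarith

lemma strongG_subset_genericG {V : Set (ProbabilityMeasure X)} (hV : IsClosed V) :
    strongG T V ⊆ genericG T V :=
  subset_inter (fun _ hx => hx.1) (strongG_subset_lowerG hV)

/-- This is where the second clause of `strongG` matters: when `X` is not compact, `μ` being the
only limit point does not by itself force convergence. -/
lemma strongG_singleton_subset_genericPts (μ : ProbabilityMeasure X) :
    strongG T {μ} ⊆ genericPts T μ := by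
  intro x hx
  rw [mem_genericPts_iff, Metric.tendsto_nhds]
  intro ε hε
  filter_upwards [hx.2 ε hε] with n hn
  simpa using hn

lemma Follows.mem_limitMeasures {r : ℝ} {x : X} {m : ℕ → BLip X →ᵇ ℝ} (h : Follows T r x m)
    {μ : ProbabilityMeasure X} (hμ : ∀ ε > 0, ∀ n : ℕ, ∃ j ≥ n, dist (m j) (embed μ) < ε) :
    μ ∈ limitMeasures T x := by
  obtain ⟨N, hN, hN0, hNm⟩ := h
  rw [mem_limitMeasures_iff]
  intro ε hε n
  obtain ⟨j₀, hj₀⟩ := eventually_atTop.1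
    ((tendsto_div_two_pow r).eventually_lt_const (show (0 : ℝ) < ε / 2 by positivity))
  obtain ⟨j, hj, hd⟩ := hμ (ε / 2) (by positivity) (max j₀ (n + 1))
  have h1 : j ≤ N j := hN.le_apply
  have h2 := hj₀ j (by omega)
  have h3 := (hNm j).1
  refine ⟨N j - 1, by omega, ?_⟩
  rw [show N j - 1 + 1 = N j by omega]
  rw [← dist_eq_norm] at h3
  have := dist_triangle (avg T (N j) x) (m j) (embed μ)
  linarith

/-- Between two stage ends the averages stay near the next target up to the distance of consecutive
targets, which vanishes; hence they never leave a small neighbourhood of `V` for long times. -/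
lemma Follows.mem_strongG {r : ℝ} {x : X} {m u : ℕ → BLip X →ᵇ ℝ} (h : Follows T r x m)
    {V : Set (ProbabilityMeasure X)} (huV : ∀ j, u j ∈ embed '' V)
    (hu : Tendsto (fun j => dist (u j) (u (j + 1))) atTop (𝓝 0))
    (huc : ∀ w ∈ embed '' V, MapClusterPt w atTop u)
    (hmu : Tendsto (fun j => dist (m j) (u j)) atTop (𝓝 0)) : x ∈ strongG T V := by
  refine ⟨fun μ hμ => h.mem_limitMeasures fun ε hε n => ?_, fun ε hε => ?_⟩
  · have h1 := (huc _ (mem_image_of_mem _ hμ)).frequently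
      (Metric.ball_mem_nhds _ (show 0 < ε / 2 by positivity))
    have h2 := hmu.eventually_lt_const (show (0 : ℝ) < ε / 2 by positivity)
    obtain ⟨j, hj1, hj2, hj3⟩ := (h1.and_eventually (h2.and (eventually_ge_atTop n))).exists
    refine ⟨j, hj3, ?_⟩
    have := dist_triangle (m j) (u j) (embed μ)
    linarith
  · obtain ⟨N, hN, hN0, hNm⟩ := h
    have e1 := hmu.eventually_lt_const (show (0 : ℝ) < ε / 5 by positivity)
    have e2 := hu.eventually_lt_const (show (0 : ℝ) < ε / 5 by positivity)
    have e3 := (tendsto_div_two_pow r).eventually_lt_const (show (0 : ℝ) < ε / 5 by positivity)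
    obtain ⟨j₀, hj₀⟩ := eventually_atTop.1 (e1.and (e2.and e3))
    filter_upwards [eventually_ge_atTop (N j₀)] with i hi
    -- Locates `i + 1` between consecutive stage ends. Five errors below `ε / 5` then add up; the
    -- distance of `m (j + 1)` to `u (j + 1)` counts twice.
    have hex : ∃ j, i + 1 ≤ N (j + 1) := ⟨i, hN.le_apply⟩
    classical
    obtain ⟨j, hj₀j, hj1, hj2⟩ : ∃ j ≥ j₀, N j ≤ i + 1 ∧ i + 1 ≤ N (j + 1) := by
      have hspec := Nat.find_spec hex
      have hge : j₀ ≤ Nat.find hex := by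
        have := hN.lt_iff_lt.1 (lt_of_lt_of_le (Nat.lt_succ_of_le hi) hspec)
        omega
      refine ⟨Nat.find hex, hge, ?_, hspec⟩
      rcases Nat.eq_zero_or_pos (Nat.find hex) with h0 | hpos
      · rw [h0] at hge ⊢
        rw [Nat.le_zero.1 hge] at hi
        omega
      · have := Nat.find_min hex (Nat.sub_lt hpos one_pos)
        rw [show Nat.find hex - 1 + 1 = Nat.find hex by omega] at this
        omega
    obtain ⟨a1, a2, a3⟩ := hj₀ j hj₀j
    obtain ⟨b1, b2, b3⟩ := hj₀ (j + 1) (by omega)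
    have h1 := (hNm j).2 (i + 1) hj1 hj2
    rw [← dist_eq_norm, ← dist_eq_norm] at h1
    obtain ⟨v, hv, hvu⟩ := huV (j + 1)
    refine ⟨v, hv, ?_⟩
    rw [hvu]
    have t1 := dist_triangle (avg T (i + 1) x) (m (j + 1)) (u (j + 1))
    have t2 := dist_triangle4 (m j) (u j) (u (j + 1)) (m (j + 1))
    rw [dist_comm (u (j + 1)) (m (j + 1))] at t2
    linarith

lemma exists_slow_sequence_embed {V : Set (ProbabilityMeasure X)} (hV : IsPreconnected V)
    {v : ProbabilityMeasure X} (hv : v ∈ V) :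
    ∃ u : ℕ → BLip X →ᵇ ℝ, (∀ j, u j ∈ embed '' V) ∧ {j | u j = embed v}.Infinite ∧
      Tendsto (fun j => dist (u j) (u (j + 1))) atTop (𝓝 0) ∧
      ∀ w ∈ embed '' V, MapClusterPt w atTop u :=
  exists_slow_dense_sequence (hV.image _ continuous_embed.continuousOn)
    (isSeparable_range_embed.mono (image_subset_range _ _)) (mem_image_of_mem _ hv)

theorem dense_strongG [CompleteSpace X] (hT : Continuous T) (h : HasSAPS T)
    {V : Set (ProbabilityMeasure X)} (hVT : V ⊆ invMeasures T) (hV : IsConnected V) :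
    Dense (strongG T V) := by
  obtain ⟨⟨v, hv⟩, hV⟩ := hV
  obtain ⟨u, huV, -, hu, huc⟩ := exists_slow_sequence_embed hV hv
  rw [Metric.dense_iff]
  intro x₀ r hr
  obtain ⟨F, hF, -, hFN⟩ := h.exists_follow hT x₀ (half_pos hr)
  have huA (j) : IsApproximable T (u j) := by
    obtain ⟨μ, hμ, he⟩ := huV j
    exact he ▸ isApproximable_embed hT (hVT hμ)
  have hf : Follows T (r / 2) (F fun j => ⟨u j, huA j⟩) u := hFN _
  refine ⟨F fun j => ⟨u j, huA j⟩, ?_, hf.mem_strongG huV hu huc (by simp)⟩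
  rw [Metric.mem_ball]
  exact (hF _).trans_lt (half_lt_self hr)

/-- One statement serves G_μ, G_V, G(V) and the complement of ᵁG: each contains `strongG` and misses
ᵁG. -/
theorem not_isSigma0_three_of_strongG_subset [CompleteSpace X] (hT : Continuous T) (h : HasSAPS T)
    {V : Set (ProbabilityMeasure X)} (hVT : V ⊆ invMeasures T) (hVc : IsClosed V)
    (hV : IsConnected V) (hU : (invMeasures T \ V).Nonempty) {A : Set X} (hA : strongG T V ⊆ A)
    (hAU : ∀ x ∈ A, x ∉ meetG T (invMeasures T \ V)) : ¬ IsSigma0 3 A := by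
  intro hA3
  obtain ⟨G, hG, rfl⟩ := hA3.exists_isGδ_of_three
  obtain ⟨⟨v', hv'⟩, hV⟩ := hV
  obtain ⟨w, hw⟩ := hU
  obtain ⟨v, hv, e, heU, hev⟩ := exists_tendsto_embed_of_notMem hVc hVT hv' hw
  obtain ⟨u, huV, hJ, hu, huc⟩ := exists_slow_sequence_embed hV hv
  obtain ⟨x₀⟩ := v.nonempty
  obtain ⟨F, -, hFc, hFN⟩ := h.exists_follow hT x₀ one_pos
  have huA (j) : IsApproximable T (u j) := by
    obtain ⟨μ, hμ, he⟩ := huV j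
    exact he ▸ isApproximable_embed hT (hVT hμ)
  classical
  -- If `α` tends to infinity, `e (α j)` tends to `v` and the change of targets is asymptotically
  -- invisible; if `α` repeats `k` along the visits to `v`, then `e k` is a limit measure outside
  -- `V`.
  let m : (ℕ → ℕ) → ℕ → {m : BLip X →ᵇ ℝ // IsApproximable T m} := fun α j =>
    if u j = embed v then ⟨embed (e (α j)), isApproximable_embed hT (heU _).1⟩ else ⟨u j, huA j⟩
  let f : (ℕ → ℕ) → X := fun α => F (m α)
  have hf : Continuous f := by
    rw [continuous_iff_continuousAt]
    intro α
    rw [ContinuousAt, Metric.tendsto_nhds]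
    intro ε hε
    obtain ⟨j, hj⟩ := ((tendsto_div_two_pow 1).eventually_lt_const hε).exists
    have hev : ∀ᶠ β in 𝓝 α, ∀ i ∈ Finset.range (j + 1), β i = α i := by
      rw [Filter.eventually_all_finset]
      intro i _
      exact (continuous_apply i).continuousAt.eventually
        (show ∀ᶠ b in 𝓝 (α i), b = α i by simp [nhds_discrete])
    filter_upwards [hev] with β hβ
    refine (hFc _ _ j fun i hi => ?_).trans_lt hj
    simp only [m, hβ i (Finset.mem_range.2 (Nat.lt_succ_of_le hi))]
  have hfol (α) : Follows T 1 (f α) fun j => (m α j : BLip X →ᵇ ℝ) := hFN _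
  have hgood (α : ℕ → ℕ) (hα : Tendsto α atTop atTop) : f α ∈ strongG T V := by
    refine (hfol α).mem_strongG huV hu huc ?_
    have h0 := tendsto_iff_dist_tendsto_zero.1 (hev.comp hα)
    refine squeeze_zero (fun _ => dist_nonneg) (fun j => ?_) h0
    by_cases hj : u j = embed v
    · simp [m, hj]
    · simp [m, hj]
  obtain ⟨α, hα, k, hk⟩ := exists_mem_iUnion_isGδ hJ (G := fun i => f ⁻¹' G i)
    (fun i => (hG i).preimage hf) (fun α hα => by
      rw [← preimage_iUnion]
      exact hA (hgood α hα))
  rw [← preimage_iUnion] at hα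
  refine hAU _ hα ⟨e k, (hfol α).mem_limitMeasures fun ε hε n => ?_, heU k⟩
  obtain ⟨j, hj, hnj, hjk⟩ := hk n
  refine ⟨j, hnj, ?_⟩
  have hj' : u j = embed v := hj
  simpa [m, hj', hjk] using hε

lemma isPi0_three_genericPts (hT : Continuous T) (μ : ProbabilityMeasure X) :
    IsPi0 3 (genericPts T μ) := by
  have : genericPts T μ = ⋂ q : ℕ, ⋃ n : ℕ, ⋂ i ≥ n,
      {x | dist (avg T (i + 1) x) (embed μ) ≤ 1 / ((q : ℝ) + 1)} := by
    ext x
    rw [mem_genericPts_iff, Metric.nhds_basis_closedBall_inv_nat_succ.tendsto_right_iff]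
    simp [eventually_atTop]
  rw [this]
  exact isPi0_three_iInter_iUnion fun q n => isClosed_biInter fun i _ =>
    isClosed_le ((continuous_avg hT _).dist continuous_const) continuous_const

/-- Separability reduces the condition to countably many points of `embed '' V`, each approached
infinitely often within each `1 / (q + 1)`. -/
lemma isGδ_upperG (hT : Continuous T) {V : Set (ProbabilityMeasure X)} (hV : V.Nonempty) :
    IsGδ (upperG T V) := by
  let W := embed '' V
  have : Nonempty W := (hV.image _).to_subtype
  have : TopologicalSpace.SeparableSpace W :=
    (isSeparable_range_embed.mono (image_subset_range _ V)).separableSpace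
  let d : ℕ → W := TopologicalSpace.denseSeq W
  have : upperG T V = ⋂ (k : ℕ) (q : ℕ) (n : ℕ), ⋃ i ≥ n,
      {x | dist (avg T (i + 1) x) (d k) < 1 / ((q : ℝ) + 1)} := by
    ext x
    simp only [mem_iInter, mem_iUnion, exists_prop]
    constructor
    · intro hx k q n
      obtain ⟨μ, hμ, hd⟩ := (d k).2
      have := mem_limitMeasures_iff.1 (hx hμ) (1 / ((q : ℝ) + 1)) (by positivity) n
      rwa [hd] at this
    · intro hx μ hμ
      rw [mem_limitMeasures_iff]
      intro ε hε n
      obtain ⟨q, hq⟩ := exists_nat_one_div_lt (half_pos hε)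
      obtain ⟨k, hk⟩ := (TopologicalSpace.denseRange_denseSeq W).exists_dist_lt
        ⟨embed μ, mem_image_of_mem _ hμ⟩ (half_pos hε)
      obtain ⟨i, hi, hd⟩ := hx k q n
      refine ⟨i, hi, ?_⟩
      have h1 := dist_triangle_right (avg T (i + 1) x) (embed μ) (d k)
      have h2 : dist (embed μ) (d k) < ε / 2 := hk
      have h3 : dist (avg T (i + 1) x) (d k) < 1 / ((q : ℝ) + 1) := hd
      linarith
  rw [this]
  exact IsGδ.iInter fun k => IsGδ.iInter fun q => IsGδ.iInter_of_isOpen fun n =>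
    isOpen_biUnion fun i _ => isOpen_lt ((continuous_avg hT _).dist continuous_const)
      continuous_const

lemma not_isSigma0_two_upperG [CompleteSpace X] (hT : Continuous T) (h : HasSAPS T)
    {V : Set (ProbabilityMeasure X)} (hVT : V ⊆ invMeasures T) (hV : IsConnected V)
    (hU : (invMeasures T \ V).Nonempty) : ¬ IsSigma0 2 (upperG T V) := by
  intro h2
  obtain ⟨w, hw⟩ := hU
  obtain ⟨v, hv⟩ := hV.nonempty
  have : Nonempty X := v.nonempty
  have hdw : Dense (strongG T {w}) :=
    dense_strongG hT h (singleton_subset_iff.2 hw.1) isConnected_singleton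
  have hsub : strongG T {w} ⊆ (upperG T V)ᶜ := by
    intro x hx hxV
    have : v = w := strongG_subset_lowerG isClosed_singleton hx (hxV hv)
    exact hw.2 (this ▸ hv)
  have hd := (dense_strongG hT h hVT hV).mono (fun _ hx => hx.1)
  obtain ⟨x, hx, hx'⟩ := (hd.inter_of_Gδ (isGδ_upperG hT hV.nonempty) h2.isGδ_compl_of_two
    (hdw.mono hsub)).nonempty
  exact hx' hx

end Main

end PolishDyn

end

theorem mainTheorem1 {X : Type*} [MetricSpace X] [CompleteSpace X]
    [TopologicalSpace.SeparableSpace X] [MeasurableSpace X] [BorelSpace X]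
    (T : X → X) (hT : Continuous T) (hSAPS : PolishDyn.HasSAPS T) :
    ((PolishDyn.invMeasures T).Nontrivial →
      ∀ μ ∈ PolishDyn.invMeasures T,
        PolishDyn.IsPi0Complete 3 (PolishDyn.genericPts T μ)) ∧
    (∀ V U : Set (ProbabilityMeasure X), V ⊆ PolishDyn.invMeasures T → V.Nonempty →
      IsClosed V → IsConnected V → U = PolishDyn.invMeasures T \ V → U.Nonempty →
        PolishDyn.IsPi0Hard 3 (PolishDyn.lowerG T V) ∧
        PolishDyn.IsPi0Hard 3 (PolishDyn.genericG T V) ∧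
        PolishDyn.IsSigma0Hard 3 (PolishDyn.meetG T U) ∧
        PolishDyn.IsPi0Complete 2 (PolishDyn.upperG T V) ∧
        Dense (PolishDyn.lowerG T V) ∧ Dense (PolishDyn.upperG T V) ∧
        Dense (PolishDyn.genericG T V) ∧ Dense (PolishDyn.meetG T U)) := by
  open PolishDyn in
  refine ⟨fun hn μ hμ => ⟨isPi0_three_genericPts hT μ, ?_⟩, ?_⟩
  · obtain ⟨w, hw, hwμ⟩ := hn.exists_ne μ
    have hVT : {μ} ⊆ invMeasures T := singleton_subset_iff.2 hμ
    refine not_isSigma0_three_of_strongG_subset hT hSAPS hVT isClosed_singleton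
      isConnected_singleton ⟨w, hw, hwμ⟩ (strongG_singleton_subset_genericPts μ) ?_
    rintro x hx ⟨ν, hν, -, hνμ⟩
    have hc : ClusterPt ν (𝓝 μ) := ClusterPt.mono hν hx
    exact hνμ (eq_of_nhds_neBot hc)
  · rintro V U hVT - hVc hV rfl hU
    have hd := dense_strongG hT hSAPS hVT hV
    have hard : ∀ A : Set X, strongG T V ⊆ A → (∀ x ∈ A, x ∉ meetG T (invMeasures T \ V)) →
        ¬ IsSigma0 3 A := fun A => not_isSigma0_three_of_strongG_subset hT hSAPS hVT hVc hV hU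
    have hlow : ∀ x ∈ lowerG T V, x ∉ meetG T (invMeasures T \ V) :=
      fun x hx ⟨ν, hν, _, hνV⟩ => hνV (hx hν)
    have hmeet : strongG T V ⊆ (meetG T (invMeasures T \ V))ᶜ := fun x hx =>
      hlow x (strongG_subset_lowerG hVc hx)
    refine ⟨hard _ (strongG_subset_lowerG hVc) hlow,
      hard _ (strongG_subset_genericG hVc) fun x hx => hlow x hx.2, hard _ hmeet fun x hx => hx,
      ⟨isPi0_two_of_isGδ (isGδ_upperG hT hV.nonempty), not_isSigma0_two_upperG hT hSAPS hVT hV hU⟩,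
      hd.mono (strongG_subset_lowerG hVc), hd.mono (fun _ hx => hx.1),
      hd.mono (strongG_subset_genericG hVc), ?_⟩
    -- Density of ᵁG comes from points generic for a single measure in `U`.
    obtain ⟨w, hw⟩ := hU
    exact (dense_strongG hT hSAPS (singleton_subset_iff.2 hw.1) isConnected_singleton).mono
      fun x hx => ⟨w, hx.1 rfl, hw⟩
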